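/- All objects are real and smooth, $u=(u^1,\dots,u^N)$, subscripts on functions denote partial derivatives, $\Phi_{ijk}=\partial^3\Phi/\partial u^i\partial u^j\partial u^k$, and repeated indices are summed from $1$ to $N$. A *Frobenius manifold* (Dubrovin) is an $N$-dimensional manifold with a flat pseudo-Riemannian metric $g$ and a smooth commutative associative multiplication $\circ$ on the tangent spaces such that $g(X\circ Y,Z)=g(X,Y\circ Z)$; the tensor $\nabla A$, where $A(X,Y,Z)=g(X\circ Y,Z)$, is totally symmetric; there is a unit vector field $e$ with $\nabla e=0$; and there is an Euler vector field $E$ with $\nabla\nabla E=0$, $\mathcal L_E(X\circ Y)-(\mathcal L_EX)\circ Y-X\circ(\mathcal L_EY)=X\circ Y$, $\mathcal L_Eg=Kg$ ($K$ a constant), $\mathcal L_Ee=-e$. It is *given by* a function $\Phi$ in flat coordinates $u$ if in these coordinates $g=\eta_{ij}du^idu^j$ is constant and $\partial_i\circ\partial_j=\eta^{ks}\Phi_{sij}\,\partial_k$, where $(\eta^{ij})=(\eta_{ij})^{-1}$. The *associativity (WDVV) equations* are $$\Phi_{ijk}\,\eta^{kl}\,\Phi_{lmn}=\Phi_{imk}\,\eta^{kl}\,\Phi_{ljn}.\qquad(\mathrm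 W)$$ Let $(\eta_{ij})$ be a constant symmetric nondegenerate matrix, $c\neq0$ a constant, $U\subset\mathbb R^N$ open and $\Phi$ a smooth function on $U$. Consider the linear system $$r_{ij}=c\,\eta^{kl}\Phi_{ijk}\,n_l,\qquad n_{ij}=-\eta^{kl}\Phi_{ijk}\,r_l\qquad(\mathrm L)$$ for $2N$-component vector functions $r(u),n(u)$. It is *consistent* on $U$ if near every $u_0\in U$ there is a solution with arbitrarily prescribed $r(u_0),n(u_0),r_i(u_0),n_i(u_0)$. For a pseudo-Euclidean scalar product $(\cdot,\cdot)$ on $\mathbb R^{2N}$ and an open $V\subset U$, a *potential flat torsionless submanifold that belongs to $(\eta,c,\Phi)$ on $V$* is an immersion $r:V\to\mathbb R^{2N}$ together with smooth normal fields $b_1,\dots,b_N$ such that $(r_i,r_j)=\eta_{ij}$, $(b_\alpha,r_i)=0$, $(b_\alpha,b_\beta)=c^{-1}\eta_{\alpha\beta}$, the torsion vanishes, $(\partial_ib_\alpha,b_\beta)=0$, and the second fundamental forms are $(b_\alpha,r_{ij})=\Phi_{\alpha ij}$. The signature of a form is the number of its plus signs minus the number of its minus signs. **Theorem.** (1) Every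 Frobenius manifold is, near each of its points, given in some flat coordinates by a function $\Phi$. Whenever it is given by $\Phi$ in flat coordinates $u$, $\Phi$ satisfies (W), and, for every $c\ne0$, every submanifold that belongs to $(\eta,c,\Phi)$ on an open subset of the coordinate domain realizes the Frobenius manifold: its first fundamental form is $g_{ij}$, and $\partial_i\circ\partial_j=g^{ks}\omega_{i,sj}\,\partial_k$, where $\omega_{i,sj}=(b_i,r_{sj})$. So $c$ is a deformation parameter that preserves the Frobenius structure. (2) For every $c\neq0$, the system (L) is consistent on $U$ if and only if $\Phi$ satisfies (W) on $U$. (3) Let $\Phi$ satisfy (W) on $U$, and let $c\ne0$. For every pseudo-Euclidean scalar product on $\mathbb R^{2N}$: (a) if $(r,b)$ is a submanifold that belongs to $(\eta,c,\Phi)$ on an open $V\subset U$, then near every point of $V$ there is $n$ with $n_\alpha=b_\alpha$ such that $(r,n)$ satisfies (L); (b) conversely, if $V\subset U$ is open and connected, $(r,n)$ is a smooth solution of (L) on $V$, and at one point of $V$ one has $(r_i,r_j)=\eta_{ij}$, $(n_i,r_j)=0$, $(n_i,n_j)=c^{-1}\eta_{ij}$, then $r$ with the normals $n_1,\dots,n_N$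 is a submanifold that belongs to $(\eta,c,\Phi)$ on $V$; (c) the submanifold is unique up to motions: over a connected open $V\subset U$, any two of them (with their normal frames) are carried to each other by a motion of the ambient space; (d) for each $u_0\in U$, such a submanifold given by a solution $(r,n)$ of (L), with normals $n_\alpha$, exists near $u_0$ if and only if the signature of the ambient space is $2\,\mathrm{sign}(\eta)$ in the case $c>0$, and $0$ in the case $c<0$. Ambient spaces of this signature exist. In particular, if the signature of $\eta$ is nonzero, the values $c=1$ and $c=-1$ correspond to ambient spaces of different signatures. -/

import Mathlib

open scoped ContDiff Manifold

noncomputable section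

namespace PotentialSubmanifold

/-- The coordinate space of the variables `u = (u¹, …, u^N)`. -/
abbrev Coord (N : ℕ) : Type := Fin N → ℝ

/-- The vector space underlying the `2N`-dimensional ambient pseudo-Euclidean space. -/
abbrev Ambient (N : ℕ) : Type := Fin (2 * N) → ℝ

/-- The partial derivative `∂f / ∂uⁱ`. -/
def pd {N : ℕ} {E : Type*} [NormedAddCommGroup E] [NormedSpace ℝ E]
    (i : Fin N) (f : Coord N → E) (u : Coord N) : E :=
  fderiv ℝ f u (Pi.single i 1)

/-- The third partial derivative `∂³Φ / ∂uⁱ∂uʲ∂uᵏ`. -/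
def third {N : ℕ} (Φ : Coord N → ℝ) (i j k : Fin N) (u : Coord N) : ℝ :=
  pd i (pd j (pd k Φ)) u

/-- A constant metric `η_ij`: a symmetric nondegenerate matrix.
Its inverse matrix `η⁻¹` is `η^ij`. -/
def IsMetricMatrix {N : ℕ} (η : Matrix (Fin N) (Fin N) ℝ) : Prop :=
  η.IsSymm ∧ η.det ≠ 0

/-- The associativity (WDVV) equations for the potential `Φ` on `U`:
`Φ_ijk η^kl Φ_lmn = Φ_imk η^kl Φ_ljn`. -/
def WDVV {N : ℕ} (η : Matrix (Fin N) (Fin N) ℝ) (Φ : Coord N → ℝ) (U : Set (Coord N)) : Prop :=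
  ∀ u ∈ U, ∀ i j m n : Fin N,
    ∑ k, ∑ l, third Φ i j k u * η⁻¹ k l * third Φ l m n u =
      ∑ k, ∑ l, third Φ i m k u * η⁻¹ k l * third Φ l j n u

/-- `(r, n)` is a smooth solution on `V` of the linear system
`r_ij = c η^kl Φ_ijk n_l`, `n_ij = - η^kl Φ_ijk r_l`. -/
structure SolvesSystem {N : ℕ} (η : Matrix (Fin N) (Fin N) ℝ) (c : ℝ) (Φ : Coord N → ℝ)
    (V : Set (Coord N)) (r n : Coord N → Ambient N) : Prop where
  smooth_r : ContDiffOn ℝ ∞ r V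
  smooth_n : ContDiffOn ℝ ∞ n V
  eq_r : ∀ u ∈ V, ∀ i j : Fin N,
    pd i (pd j r) u = c • ∑ k, ∑ l, (η⁻¹ k l * third Φ i j k u) • pd l n u
  eq_n : ∀ u ∈ V, ∀ i j : Fin N,
    pd i (pd j n) u = -∑ k, ∑ l, (η⁻¹ k l * third Φ i j k u) • pd l r u

/-- Consistency (compatibility) of the overdetermined linear system on `U`: near every point of
`U` it has a solution with arbitrarily prescribed values of the vector functions `r`, `n` and of
their first derivatives at that point. -/
def IsConsistent {N : ℕ} (η : Matrix (Fin N) (Fin N) ℝ) (c : ℝ) (Φ : Coord N → ℝ)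
    (U : Set (Coord N)) : Prop :=
  ∀ u₀ ∈ U, ∀ (r₀ n₀ : Ambient N) (r₁ n₁ : Fin N → Ambient N),
    ∃ V : Set (Coord N), IsOpen V ∧ u₀ ∈ V ∧ V ⊆ U ∧
      ∃ r n : Coord N → Ambient N, SolvesSystem η c Φ V r n ∧
        r u₀ = r₀ ∧ n u₀ = n₀ ∧ (∀ i, pd i r u₀ = r₁ i) ∧ (∀ i, pd i n u₀ = n₁ i)

/-! ### Submanifolds of pseudo-Euclidean spaces -/

/-- `G` is a pseudo-Euclidean scalar product. -/
def IsPseudoEuclidean {N : ℕ} (G : LinearMap.BilinForm ℝ (Ambient N)) : Prop :=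
  G.IsSymm ∧ G.Nondegenerate

/-- The signature of a symmetric bilinear form: the number of plus signs minus the number of
minus signs in its normal form. -/
def signature {E : Type*} [AddCommGroup E] [Module ℝ E] (G : LinearMap.BilinForm ℝ E) : ℤ :=
  (sigPos G.toQuadraticMap : ℤ) - (sigNeg G.toQuadraticMap : ℤ)

/-- The coefficient `g_ij = (r_i, r_j)` of the first fundamental form. -/
def firstForm {N : ℕ} (G : LinearMap.BilinForm ℝ (Ambient N)) (r : Coord N → Ambient N)
    (u : Coord N) : Matrix (Fin N) (Fin N) ℝ :=
  Matrix.of fun i j => G (pd i r u) (pd j r u)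

/-- The coefficient `ω_{α,ij} = (b_α, r_ij)` of the second fundamental form of the submanifold `r`
that belongs to the normal field `b_α`. -/
def secondForm {N : ℕ} (G : LinearMap.BilinForm ℝ (Ambient N)) (r : Coord N → Ambient N)
    (b : Fin N → Coord N → Ambient N) (α i j : Fin N) (u : Coord N) : ℝ :=
  G (b α u) (pd i (pd j r) u)

/-- The torsion coefficient `ϰ_{αβ,i} = (∂_i b_α, b_β)`. -/
def torsion {N : ℕ} (G : LinearMap.BilinForm ℝ (Ambient N))
    (b : Fin N → Coord N → Ambient N) (α β i : Fin N) (u : Coord N) : ℝ :=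
  G (pd i (b α) u) (b β u)

/-- The smooth map `r` with the frame `b_1, …, b_N` of normal fields is, over `V`, the potential
flat torsionless submanifold of the pseudo-Euclidean space `(ℝ^{2N}, G)` that belongs to `Φ`:
an immersion whose first fundamental form is the constant metric `η` (so `u` are flat
coordinates), whose normal frame has the constant Gram matrix `μ_{αβ} = c⁻¹ η_{αβ}` and zero
torsion, and whose second fundamental forms are given by `ω_{α,ij} = ∂³Φ/∂u^α∂uⁱ∂uʲ`. -/
structure IsPotentialSubmanifold {N : ℕ} (G : LinearMap.BilinForm ℝ (Ambient N))
    (η : Matrix (Fin N) (Fin N) ℝ) (c : ℝ) (Φ : Coord N → ℝ) (V : Set (Coord N))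
    (r : Coord N → Ambient N) (b : Fin N → Coord N → Ambient N) : Prop where
  smooth_r : ContDiffOn ℝ ∞ r V
  smooth_b : ∀ α, ContDiffOn ℝ ∞ (b α) V
  immersion : ∀ u ∈ V, LinearIndependent ℝ fun i => pd i r u
  first_form : ∀ u ∈ V, firstForm G r u = η
  normal : ∀ u ∈ V, ∀ α i, G (b α u) (pd i r u) = 0
  gram : ∀ u ∈ V, ∀ α β, G (b α u) (b β u) = c⁻¹ * η α β
  torsionless : ∀ u ∈ V, ∀ α β i, torsion G b α β i u = 0
  second_form : ∀ u ∈ V, ∀ α i j, secondForm G r b α i j u = third Φ α i j u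

/-- Near `u₀ ∈ U` a solution `(r, n)` of the linear system realizes `Φ` as a potential flat
torsionless submanifold of `(ℝ^{2N}, G)`, with the normal frame `∂n/∂u^α`. -/
def IsRealizableNear {N : ℕ} (G : LinearMap.BilinForm ℝ (Ambient N))
    (η : Matrix (Fin N) (Fin N) ℝ) (c : ℝ) (Φ : Coord N → ℝ) (U : Set (Coord N))
    (u₀ : Coord N) : Prop :=
  ∃ V : Set (Coord N), IsOpen V ∧ u₀ ∈ V ∧ V ⊆ U ∧
    ∃ r n : Coord N → Ambient N, SolvesSystem η c Φ V r n ∧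
      IsPotentialSubmanifold G η c Φ V r fun α => pd α n

/-! ### Frobenius manifolds -/

section Components

variable {N : ℕ} {M : Type*} [TopologicalSpace M] [ChartedSpace (Coord N) M]

/-- The coordinate vector `∂/∂uⁱ` of the chart `φ` at the point with coordinates `y`. -/
def coordVec (φ : OpenPartialHomeomorph M (Coord N)) (y : Coord N) (i : Fin N) :
    TangentSpace 𝓘(ℝ, Coord N) (φ.symm y) :=
  mfderiv 𝓘(ℝ, Coord N) 𝓘(ℝ, Coord N) φ.symm y (Pi.single i 1 : Coord N)

/-- The components in the chart `φ` of a tangent vector at the point with coordinates `y`. -/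
def vecComp (φ : OpenPartialHomeomorph M (Coord N)) (y : Coord N)
    (v : TangentSpace 𝓘(ℝ, Coord N) (φ.symm y)) : Coord N :=
  mfderiv 𝓘(ℝ, Coord N) 𝓘(ℝ, Coord N) φ (φ.symm y) v

/-- The components `g_ij` of a metric in the chart `φ`. -/
def metricComp (g : ∀ p : M, LinearMap.BilinForm ℝ (TangentSpace 𝓘(ℝ, Coord N) p))
    (φ : OpenPartialHomeomorph M (Coord N)) (y : Coord N) : Matrix (Fin N) (Fin N) ℝ :=
  Matrix.of fun i j => g (φ.symm y) (coordVec φ y i) (coordVec φ y j)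

/-- The structural functions `cᵏ_ij` of a multiplication of tangent vectors in the chart `φ`. -/
def mulComp (mul : ∀ p : M, TangentSpace 𝓘(ℝ, Coord N) p →ₗ[ℝ]
      TangentSpace 𝓘(ℝ, Coord N) p →ₗ[ℝ] TangentSpace 𝓘(ℝ, Coord N) p)
    (φ : OpenPartialHomeomorph M (Coord N)) (k i j : Fin N) (y : Coord N) : ℝ :=
  vecComp φ y (mul (φ.symm y) (coordVec φ y i) (coordVec φ y j)) k

/-- The components `A_ijk = g(∂_i ∘ ∂_j, ∂_k)` in the chart `φ`. -/
def cubicComp (g : ∀ p : M, LinearMap.BilinForm ℝ (TangentSpace 𝓘(ℝ, Coord N) p))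
    (mul : ∀ p : M, TangentSpace 𝓘(ℝ, Coord N) p →ₗ[ℝ]
      TangentSpace 𝓘(ℝ, Coord N) p →ₗ[ℝ] TangentSpace 𝓘(ℝ, Coord N) p)
    (φ : OpenPartialHomeomorph M (Coord N)) (i j k : Fin N) (y : Coord N) : ℝ :=
  g (φ.symm y) (mul (φ.symm y) (coordVec φ y i) (coordVec φ y j)) (coordVec φ y k)

/-- The component `Xᵏ` of a vector field in the chart `φ`. -/
def fieldComp (X : ∀ p : M, TangentSpace 𝓘(ℝ, Coord N) p)
    (φ : OpenPartialHomeomorph M (Coord N)) (k : Fin N) (y : Coord N) : ℝ :=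
  vecComp φ y (X (φ.symm y)) k

/-- The chart `φ` of the smooth manifold `M` consists of flat coordinates of `g`: it belongs to
the smooth structure, and the components of `g` in it are the constants `η_ij`. -/
def IsFlatChart (g : ∀ p : M, LinearMap.BilinForm ℝ (TangentSpace 𝓘(ℝ, Coord N) p))
    (φ : OpenPartialHomeomorph M (Coord N)) (η : Matrix (Fin N) (Fin N) ℝ) : Prop :=
  φ ∈ IsManifold.maximalAtlas 𝓘(ℝ, Coord N) ∞ M ∧ ∀ y ∈ φ.target, metricComp g φ y = η

end Components

/-- A Frobenius manifold in the sense of Dubrovin. The metric is flat, that is, flat coordinates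
exist near every point. In flat coordinates the Levi-Civita connection is the coordinate
derivative, and the differential conditions on the structure are written in these coordinates. -/
structure FrobeniusManifold (N : ℕ) (M : Type*) [TopologicalSpace M]
    [ChartedSpace (Coord N) M] where
  /-- the pseudo-Riemannian metric -/
  g : ∀ p : M, LinearMap.BilinForm ℝ (TangentSpace 𝓘(ℝ, Coord N) p)
  /-- the multiplication of tangent vectors -/
  mul : ∀ p : M, TangentSpace 𝓘(ℝ, Coord N) p →ₗ[ℝ]
    TangentSpace 𝓘(ℝ, Coord N) p →ₗ[ℝ] TangentSpace 𝓘(ℝ, Coord N) p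
  /-- the unit vector field -/
  unit : ∀ p : M, TangentSpace 𝓘(ℝ, Coord N) p
  /-- the Euler vector field -/
  euler : ∀ p : M, TangentSpace 𝓘(ℝ, Coord N) p
  /-- the constant in `ℒ_E g = K g` -/
  K : ℝ
  g_symm : ∀ p, (g p).IsSymm
  g_nondegenerate : ∀ p, (g p).Nondegenerate
  invariant : ∀ p (X Y Z : TangentSpace 𝓘(ℝ, Coord N) p),
    g p (mul p X Y) Z = g p X (mul p Y Z)
  mul_comm : ∀ p (X Y : TangentSpace 𝓘(ℝ, Coord N) p), mul p X Y = mul p Y X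
  mul_assoc : ∀ p (X Y Z : TangentSpace 𝓘(ℝ, Coord N) p),
    mul p (mul p X Y) Z = mul p X (mul p Y Z)
  unit_mul : ∀ p (X : TangentSpace 𝓘(ℝ, Coord N) p), mul p (unit p) X = X
  flat : ∀ p, ∃ (φ : OpenPartialHomeomorph M (Coord N)) (η : Matrix (Fin N) (Fin N) ℝ),
    p ∈ φ.source ∧ IsFlatChart g φ η
  smooth_mul : ∀ φ η, IsFlatChart g φ η → ∀ k i j, ContDiffOn ℝ ∞ (mulComp mul φ k i j) φ.target
  smooth_unit : ∀ φ η, IsFlatChart g φ η → ∀ k, ContDiffOn ℝ ∞ (fieldComp unit φ k) φ.target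
  smooth_euler : ∀ φ η, IsFlatChart g φ η → ∀ k, ContDiffOn ℝ ∞ (fieldComp euler φ k) φ.target
  /-- the tensor `∇A` is symmetric in its four arguments -/
  nabla_cubic : ∀ φ η, IsFlatChart g φ η → ∀ y ∈ φ.target, ∀ i j k l,
    pd l (cubicComp g mul φ i j k) y = pd k (cubicComp g mul φ i j l) y
  /-- `∇U = 0` -/
  nabla_unit : ∀ φ η, IsFlatChart g φ η → ∀ y ∈ φ.target, ∀ k i, pd i (fieldComp unit φ k) y = 0
  /-- `∇∇E = 0` -/
  nabla_nabla_euler : ∀ φ η, IsFlatChart g φ η → ∀ y ∈ φ.target, ∀ k i j,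
    pd i (pd j (fieldComp euler φ k)) y = 0
  /-- `ℒ_E(X ∘ Y) - (ℒ_E X) ∘ Y - X ∘ (ℒ_E Y) = X ∘ Y` -/
  lie_mul : ∀ φ η, IsFlatChart g φ η → ∀ y ∈ φ.target, ∀ k i j,
    (∑ l, (fieldComp euler φ l y * pd l (mulComp mul φ k i j) y
        - mulComp mul φ l i j y * pd l (fieldComp euler φ k) y
        + mulComp mul φ k l j y * pd i (fieldComp euler φ l) y
        + mulComp mul φ k i l y * pd j (fieldComp euler φ l) y)) = mulComp mul φ k i j y
  /-- `ℒ_E g(X, Y) - g(ℒ_E X, Y) - g(X, ℒ_E Y) = K g(X, Y)` -/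
  lie_metric : ∀ φ η, IsFlatChart g φ η → ∀ y ∈ φ.target, ∀ i j,
    (∑ l, (η l j * pd i (fieldComp euler φ l) y + η i l * pd j (fieldComp euler φ l) y)) =
      K * η i j
  /-- `ℒ_E U = -U` -/
  lie_unit : ∀ φ η, IsFlatChart g φ η → ∀ y ∈ φ.target, ∀ k,
    (∑ l, (fieldComp euler φ l y * pd l (fieldComp unit φ k) y
        - fieldComp unit φ l y * pd l (fieldComp euler φ k) y)) = -fieldComp unit φ k y

/-- In the flat coordinates `φ` the Frobenius manifold is given by the potential `Φ`: the metric
is `η_ij`, and the structural functions are `cᵏ_ij = η^ks ∂³Φ/∂uˢ∂uⁱ∂uʲ`. -/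
structure IsGivenBy {N : ℕ} {M : Type*} [TopologicalSpace M] [ChartedSpace (Coord N) M]
    (F : FrobeniusManifold N M) (φ : OpenPartialHomeomorph M (Coord N))
    (η : Matrix (Fin N) (Fin N) ℝ) (Φ : Coord N → ℝ) : Prop where
  metric : IsMetricMatrix η
  flat_chart : IsFlatChart F.g φ η
  smooth : ContDiffOn ℝ ∞ Φ φ.target
  structural : ∀ y ∈ φ.target, ∀ k i j,
    mulComp F.mul φ k i j y = ∑ s, η⁻¹ k s * third Φ s i j y

/-- The submanifold `r` with normal frame `b` realizes the Frobenius manifold over the part `V` of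
the chart `φ`: the metric is the first fundamental form `g_ij`, and the structural functions are
`cᵏ_ij = g^ks (ω_i)_sj`, that is, minus the coefficients of the Weingarten operators. -/
def Realizes {N : ℕ} {M : Type*} [TopologicalSpace M] [ChartedSpace (Coord N) M]
    (F : FrobeniusManifold N M) (φ : OpenPartialHomeomorph M (Coord N))
    (G : LinearMap.BilinForm ℝ (Ambient N)) (V : Set (Coord N))
    (r : Coord N → Ambient N) (b : Fin N → Coord N → Ambient N) : Prop :=
  ∀ y ∈ V, metricComp F.g φ y = firstForm G r y ∧
    ∀ k i j, mulComp F.mul φ k i j y = ∑ s, (firstForm G r y)⁻¹ k s * secondForm G r b i s j y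

end PotentialSubmanifold

end

open PotentialSubmanifold

/-! The system (L) is a first-order linear system in disguise. Let T_k be the matrix with entries
η^{sl}Φ_{kis} (rows i, columns l). The 2N vectors (p, q) = (r_i, n_i) satisfy ∂_k(p, q) = (c T_k q,
-T_k p). Composing two of these operators gives -c T_j T_i on each block, and the derivative terms
of the curvature cancel because T consists of third derivatives of one function. So zero curvature
follows once the T_i commute, and this is (W) (`wdvv_iff_coeff`, `frameOperator_flat`). Frobenius'
theorem (`exists_solution_linear_system`) and the Poincaré lemma then give solutions with arbitrary
initial data. Conversely, equality of mixed third derivatives of r for well-chosen data returns (W)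
(`isConsistent_iff_wdvv`).

Geometrically, (L) is the pair of Gauss and Weingarten formulas. A constant metric kills the
tangential part of r_ij, and zero torsion kills the normal part of ∂_i b_j, so a submanifold is
forced to satisfy (L) (`IsPotentialSubmanifold.eq_r`, `IsPotentialSubmanifold.eq_b`). In the other
direction the scalar products of the frame of a solution obey a linear system that the constants η,
0, c⁻¹η also solve. By uniqueness, correct values at one point are correct everywhere
(`SolvesSystem.isGramFrame`). Uniqueness up to motions is uniqueness for the frame system, applied
after an isometry that matches the two frames at one point.

A frame at a point identifies the ambient space with η ⊕ c⁻¹η, whose signature is 2 sign(η) for c >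
0 and 0 for c < 0. By Sylvester's law this is the only obstruction to the existence of an initial
frame.

For a Frobenius manifold the tensor A is totally symmetric and so is its derivative, hence three
integrations produce Φ (`exists_potential`). Associativity of a commutative product says that the
multiplication operators commute, which is again (W). Neither the first form nor the second forms
involve c, so every c realizes the same structure. -/

/-! ### Linear differential equations: existence along rays, Frobenius integrability, uniqueness. -/

open Set Metric in
-- The bound 1/2 makes a single Picard–Lindelöf step cover all of [0, 1]: on the ball of radius
-- `‖y₀‖` about `y₀` the speed is at most (1/2)(2‖y₀‖) = ‖y₀‖, so the solution cannot leave the ball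
-- before time 1. The norm bound is Grönwall's inequality.
theorem exists_linear_ode_solution {E : Type*} [NormedAddCommGroup E] [NormedSpace ℝ E]
    [CompleteSpace E] {B : ℝ → E →L[ℝ] E} (hB : ContinuousOn B (Icc 0 1))
    (hle : ∀ t ∈ Icc (0 : ℝ) 1, ‖B t‖ ≤ 1 / 2) (y₀ : E) :
    ∃ y : ℝ → E, y 0 = y₀ ∧ (∀ t ∈ Icc (0 : ℝ) 1, HasDerivWithinAt y (B t (y t)) (Icc 0 1) t) ∧
      ∀ t ∈ Icc (0 : ℝ) 1, ‖y t‖ ≤ ‖y₀‖ * Real.exp 1 := by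
  have hP : IsPicardLindelof (fun t y => B t y) (⟨0, by simp⟩ : Icc (0 : ℝ) 1) y₀ ‖y₀‖₊ 0 ‖y₀‖₊ 1 := by
    refine ⟨fun t ht => ?_, fun x _ => hB.clm_apply continuousOn_const, fun t ht x hx => ?_, ?_⟩
    · refine ((B t).lipschitz.weaken ?_).lipschitzOnWith
      rw [← NNReal.coe_le_coe]
      exact (hle t ht).trans (by norm_num)
    · have h1 : ‖x‖ ≤ ‖y₀‖ + ‖y₀‖ := by
        have : ‖x - y₀‖ ≤ ‖y₀‖ := by simpa [dist_eq_norm] using hx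
        calc ‖x‖ = ‖y₀ + (x - y₀)‖ := by simp
          _ ≤ _ := norm_add_le _ _
          _ ≤ _ := by gcongr
      calc ‖B t x‖ ≤ ‖B t‖ * ‖x‖ := (B t).le_opNorm x
        _ ≤ 1 / 2 * (‖y₀‖ + ‖y₀‖) := by gcongr; exact hle t ht
        _ = _ := by simp; ring
    · simp
  obtain ⟨y, hy0, hy⟩ := hP.exists_eq_forall_mem_Icc_hasDerivWithinAt₀
  refine ⟨y, hy0, hy, fun t ht => ?_⟩
  have := norm_le_gronwallBound_of_norm_deriv_right_le (f := y) (f' := fun t => B t (y t))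
    (δ := ‖y₀‖) (K := 1) (ε := 0) (a := 0) (b := 1) (fun t ht => (hy t ht).continuousWithinAt)
    (fun t ht => (hy t ⟨ht.1, ht.2.le⟩).mono_of_mem_nhdsWithin (Icc_mem_nhdsGE_of_mem ht))
    (by rw [← hy0]) (fun t ht => by
      have h1 : ‖B t (y t)‖ ≤ ‖B t‖ * ‖y t‖ := (B t).le_opNorm _
      have h2 := hle t ⟨ht.1, ht.2.le⟩
      have : ‖B t‖ * ‖y t‖ ≤ 1 * ‖y t‖ := by gcongr; linarith
      linarith) t ht
  refine this.trans ?_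
  rw [gronwallBound_ε0]
  gcongr
  simpa using ht.2

open Set Metric in
-- One constant serves for the size, the Lipschitz bound and the Taylor remainder. The quadratic
-- remainder comes from the local Lipschitz property of the derivative and the mean value inequality
-- on the segment.
theorem exists_ball_second_order_bounds {X F : Type*} [NormedAddCommGroup X] [NormedSpace ℝ X]
    [NormedAddCommGroup F] [NormedSpace ℝ F] {U : Set X} (hU : IsOpen U) {A : X → F}
    (hA : ContDiffOn ℝ ∞ A U) {x₀ : X} (hx₀ : x₀ ∈ U) :
    ∃ ρ > 0, ∃ C ≥ 0, ball x₀ ρ ⊆ U ∧ (∀ x ∈ ball x₀ ρ, ‖A x‖ ≤ C) ∧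
      (∀ x ∈ ball x₀ ρ, ∀ y ∈ ball x₀ ρ, ‖A y - A x‖ ≤ C * ‖y - x‖) ∧
      ∀ x ∈ ball x₀ ρ, ∀ y ∈ ball x₀ ρ,
        ‖A y - A x - fderiv ℝ A x (y - x)‖ ≤ C * ‖y - x‖ * ‖y - x‖ := by
  have hUn : U ∈ nhds x₀ := hU.mem_nhds hx₀
  have hA0 : ContDiffAt ℝ ∞ A x₀ := hA.contDiffAt hUn
  have hA1 : ContDiffAt ℝ 1 (fderiv ℝ A) x₀ :=
    ((contDiffOn_infty_iff_fderiv_of_isOpen hU).1 hA).2.contDiffAt hUn |>.of_le (by simp)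
  obtain ⟨K, s, hs, hK⟩ := hA1.exists_lipschitzOnWith
  obtain ⟨K', s', hs', hK'⟩ := (hA0.of_le (m := 1) (by simp)).exists_lipschitzOnWith
  obtain ⟨C₀, hC₀⟩ : ∃ C, ∀ᶠ x in nhds x₀, ‖A x‖ ≤ C := by
    refine ⟨‖A x₀‖ + 1, ?_⟩
    have := hA0.continuousAt.norm.eventually (gt_mem_nhds (lt_add_one ‖A x₀‖))
    exact this.mono fun x hx => hx.le
  obtain ⟨ρ, hρ, hball⟩ := Metric.mem_nhds_iff.1
    (Filter.inter_mem (Filter.inter_mem hUn hC₀) (Filter.inter_mem hs hs'))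
  refine ⟨ρ, hρ, max (max C₀ K) K', by positivity, fun x hx => (hball hx).1.1,
    fun x hx => (hball hx).1.2.trans (by simp), fun x hx y hy => ?_, fun x hx y hy => ?_⟩
  · have := hK'.dist_le_mul y (hball hy).2.2 x (hball hx).2.2
    rw [dist_eq_norm, dist_eq_norm] at this
    refine this.trans ?_
    gcongr
    exact le_max_right _ _
  · have hseg : segment ℝ x y ⊆ ball x₀ ρ := (convex_ball x₀ ρ).segment_subset hx hy
    refine (convex_segment x y).norm_image_sub_le_of_norm_fderiv_le' (𝕜 := ℝ)
      (fun z hz => ((hA z (hball (hseg hz)).1.1).contDiffAt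
        (hU.mem_nhds (hball (hseg hz)).1.1)).differentiableAt (by simp))
      (fun z hz => ?_) (left_mem_segment ℝ x y) (right_mem_segment ℝ x y)
    have h1 := hK.dist_le_mul z (hball (hseg hz)).2.1 x (hball hx).2.1
    rw [dist_eq_norm, dist_eq_norm] at h1
    have h2 : ‖z - x‖ ≤ ‖y - x‖ := by
      have := norm_sub_le_of_mem_segment hz
      simpa [norm_sub_rev] using this
    refine h1.trans ?_
    gcongr
    exact (le_max_right _ _).trans (le_max_left _ _)

open Set Metric in
-- Solve the equation along each ray from `x₀` and let `Y` be the value at time 1. To differentiate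
-- `Y`, the solution on a neighbouring ray is compared with an explicit first-order guess. Flatness
-- makes the guess satisfy the neighbouring equation up to O(‖h‖²), and Grönwall turns this into an
-- error O(‖h‖²) at time 1.
theorem exists_hasFDerivAt_of_flat {X E : Type*} [NormedAddCommGroup X] [NormedSpace ℝ X]
    [NormedAddCommGroup E] [NormedSpace ℝ E] [CompleteSpace E] {U : Set X} (hU : IsOpen U)
    {A : X → X →L[ℝ] E →L[ℝ] E} (hA : ContDiffOn ℝ ∞ A U)
    (hflat : ∀ x ∈ U, ∀ h k y, fderiv ℝ A x h k y + A x k (A x h y) =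
      fderiv ℝ A x k h y + A x h (A x k y))
    {x₀ : X} (hx₀ : x₀ ∈ U) (y₀ : E) :
    ∃ ρ > 0, ball x₀ ρ ⊆ U ∧ ∃ Y : X → E, Y x₀ = y₀ ∧
      ∀ x ∈ ball x₀ ρ, HasFDerivAt Y ((A x).flip (Y x)) x := by
  obtain ⟨ρ₀, hρ₀, C, hC, hballU, hA0, hA1, hA2⟩ := exists_ball_second_order_bounds hU hA hx₀
  -- The radius is shrunk so that the coefficient ‖A u‖ along a ray of length below `ρ` is at most
  -- 1/2, as the ray equation requires.
  obtain ⟨ρ, hρ, hρρ₀, hCρ⟩ : ∃ ρ > 0, ρ ≤ ρ₀ ∧ C * ρ ≤ 1 / 2 := by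
    refine ⟨min ρ₀ (1 / (2 * (C + 1))), by positivity, min_le_left _ _, ?_⟩
    calc C * min ρ₀ (1 / (2 * (C + 1))) ≤ C * (1 / (2 * (C + 1))) := by
          gcongr; exact min_le_right _ _
      _ ≤ _ := by rw [mul_one_div, div_le_div_iff₀ (by positivity) (by norm_num)]; linarith
  have hsub : ball x₀ ρ ⊆ ball x₀ ρ₀ := ball_subset_ball hρρ₀
  have hray : ∀ u : X, ‖u‖ < ρ → ∀ t ∈ Icc (0 : ℝ) 1, x₀ + t • u ∈ ball x₀ ρ := by
    intro u hu t ht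
    rw [mem_ball, dist_eq_norm, add_sub_cancel_left, norm_smul, Real.norm_of_nonneg ht.1]
    calc t * ‖u‖ ≤ 1 * ‖u‖ := by gcongr; exact ht.2
      _ < ρ := by simpa
  have hdiff : ∀ x ∈ ball x₀ ρ, HasFDerivAt A (fderiv ℝ A x) x := fun x hx =>
    (((hA x (hballU (hsub hx))).contDiffAt (hU.mem_nhds (hballU (hsub hx)))).differentiableAt
      (by simp)).hasFDerivAt
  have hline : ∀ (u : X) (t : ℝ), HasDerivAt (fun t : ℝ => x₀ + t • u) u t := fun u t => by
    simpa using ((hasDerivAt_id t).smul_const u).const_add x₀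
  have hnorm : ∀ u : X, ‖u‖ < ρ → ∀ t ∈ Icc (0 : ℝ) 1, ‖A (x₀ + t • u) u‖ ≤ 1 / 2 := by
    intro u hu t ht
    calc ‖A (x₀ + t • u) u‖ ≤ ‖A (x₀ + t • u)‖ * ‖u‖ := (A (x₀ + t • u)).le_opNorm u
      _ ≤ C * ρ := by gcongr; exact hA0 _ (hsub (hray u hu t ht))
      _ ≤ 1 / 2 := hCρ
  have hex : ∀ u : X, ∃ y : ℝ → E, ‖u‖ < ρ → (y 0 = y₀ ∧
      (∀ t ∈ Icc (0 : ℝ) 1, HasDerivWithinAt y (A (x₀ + t • u) u (y t)) (Icc 0 1) t) ∧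
      ∀ t ∈ Icc (0 : ℝ) 1, ‖y t‖ ≤ ‖y₀‖ * Real.exp 1) := by
    intro u
    by_cases hu : ‖u‖ < ρ
    · obtain ⟨y, hy⟩ := exists_linear_ode_solution (B := fun t => A (x₀ + t • u) u)
        (fun t ht => ContinuousAt.continuousWithinAt
          (((hdiff _ (hray u hu t ht)).continuousAt.comp (f := fun t : ℝ => x₀ + t • u)
            (hline u t).continuousAt).clm_apply continuousAt_const)) (hnorm u hu) y₀
      exact ⟨y, fun _ => hy⟩
    · exact ⟨0, fun h => absurd h hu⟩
  choose y hy using hex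
  set M := ‖y₀‖ * Real.exp 1 with hM
  have hM0 : 0 ≤ M := by positivity
  -- The four summands of the constant are the bounds `e2`–`e5` below; the factor e comes from
  -- Grönwall on [0, 1] with rate 1.
  have key : ∀ u : X, ‖u‖ < ρ → ∀ h : X, ‖u + h‖ < ρ → ‖h‖ ≤ ρ →
      ‖y (u + h) 1 - y u 1 - A (x₀ + u) h (y u 1)‖ ≤
        ((C * C + C * ρ + C + C * C * ρ) * M * Real.exp 1) * (‖h‖ * ‖h‖) := by
    intro u hu h huh hhρ
    obtain ⟨hz0, hz, hzM⟩ := hy (u + h) huh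
    obtain ⟨hy0, hy', hyM⟩ := hy u hu
    set z := y (u + h)
    set y := y u
    -- The guess for the solution on the ray of u + h: at time t the point has moved by t h, so the
    -- solution should move by A(t h) y(t). At t = 1 this is the derivative that is claimed.
    set w : ℝ → E := fun t => y t + t • A (x₀ + t • u) h (y t) with hw
    set w' : ℝ → E := fun t => A (x₀ + t • u) u (y t) + (t • (fderiv ℝ A (x₀ + t • u) u h (y t) +
      A (x₀ + t • u) h (A (x₀ + t • u) u (y t))) + A (x₀ + t • u) h (y t)) with hw'
    have hwd : ∀ t ∈ Icc (0 : ℝ) 1, HasDerivWithinAt w (w' t) (Icc 0 1) t := by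
      intro t ht
      have h1 : HasDerivWithinAt (fun t : ℝ => A (x₀ + t • u)) (fderiv ℝ A (x₀ + t • u) u)
          (Icc 0 1) t :=
        (HasFDerivAt.comp_hasDerivAt (l := A) (f := fun t : ℝ => x₀ + t • u) t
          (hdiff _ (hray u hu t ht)) (hline u t)).hasDerivWithinAt
      have h2 := ((h1.clm_apply (hasDerivWithinAt_const t (Icc (0 : ℝ) 1) h)).clm_apply (hy' t ht))
      have h3 := (hy' t ht).add ((hasDerivWithinAt_id t _).smul h2)
      refine h3.congr_deriv ?_
      simp [hw']
    have hIci : ∀ {f : ℝ → E} {f' : E} {t : ℝ}, t ∈ Ico (0 : ℝ) 1 →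
        HasDerivWithinAt f f' (Icc 0 1) t → HasDerivWithinAt f f' (Ici t) t :=
      fun ht hf => hf.mono_of_mem_nhdsWithin (Icc_mem_nhdsGE_of_mem ht)
    have hmain := norm_le_gronwallBound_of_norm_deriv_right_le (f := fun t => z t - w t)
      (f' := fun t => A (x₀ + t • (u + h)) (u + h) (z t) - w' t) (δ := 0) (K := 1)
      (ε := (C * C + C * ρ + C + C * C * ρ) * M * (‖h‖ * ‖h‖)) (a := 0) (b := 1)
      (fun t ht => ((hz t ht).sub (hwd t ht)).continuousWithinAt)
      (fun t ht => hIci ht ((hz t ⟨ht.1, ht.2.le⟩).sub (hwd t ⟨ht.1, ht.2.le⟩)))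
      (by simp [hw, hz0, hy0]) (fun t ht' => ?_) 1 (by simp)
    · have h1 : w 1 = y 1 + A (x₀ + u) h (y 1) := by simp [hw]
      rw [sub_sub, ← h1]
      refine hmain.trans ?_
      rw [gronwallBound_of_K_ne_0 one_ne_zero]
      simp only [zero_mul, zero_add, div_one, sub_zero, mul_one]
      have : 0 ≤ (C * C + C * ρ + C + C * C * ρ) * M * (‖h‖ * ‖h‖) := by positivity
      nlinarith [Real.exp_pos 1]
    · have ht : t ∈ Icc (0 : ℝ) 1 := ⟨ht'.1, ht'.2.le⟩
      have hx := hray u hu t ht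
      have hx' := hray _ huh t ht
      set x := x₀ + t • u with hxdef
      set x' := x₀ + t • (u + h) with hxdef'
      have hxx : x' - x = t • h := by simp [hxdef, hxdef', smul_add]
      have hfl := hflat x (hballU (hsub hx)) u h (y t)
      set R := A x' - A x - fderiv ℝ A x (x' - x) with hR
      set D := A x' - A x with hD
      have htn : ‖t • h‖ ≤ ‖h‖ := by
        rw [norm_smul, Real.norm_of_nonneg ht.1]
        exact mul_le_of_le_one_left (norm_nonneg _) ht.2
      have hRn : ‖R‖ ≤ C * (‖h‖ * ‖h‖) := by
        refine (hA2 x (hsub hx) x' (hsub hx')).trans ?_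
        rw [hxx, mul_assoc]
        gcongr
      have hDn : ‖D‖ ≤ C * ‖h‖ := by
        refine (hA1 x (hsub hx) x' (hsub hx')).trans ?_
        rw [hxx]
        gcongr
      have hAx := hA0 x (hsub hx)
      have hyt := hyM t ht
      -- Flatness exchanges u and h in the derivative of the guess, after which all terms of first
      -- order in h cancel. Besides the Grönwall term only terms quadratic in h remain.
      have hdecomp : A x' (u + h) (z t) - w' t = A x' (u + h) (z t - w t) +
          (t • A x h (A x h (y t)) + R u (y t) + D h (y t) + t • D (u + h) (A x h (y t))) := by
        have h1 : A x' = A x + t • fderiv ℝ A x h + R := by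
          rw [hR, hD, hxx, map_smul]; abel
        have h2 : D = t • fderiv ℝ A x h + R := by rw [hD, h1]; abel
        have h3 : w' t = A x u (y t) + (t • (fderiv ℝ A x h u (y t) + A x u (A x h (y t)))
            + A x h (y t)) := by
          simp only [hw', ← hxdef, hfl]
        have h4 : w t = y t + t • A x h (y t) := rfl
        rw [h3, h2, h1, h4]
        simp only [map_add, map_sub, map_smul, add_apply,
          smul_apply, smul_add]
        abel
      rw [hdecomp]
      have e1 : ‖A x' (u + h) (z t - w t)‖ ≤ 1 * ‖z t - w t‖ := by
        refine ((A x' (u + h)).le_opNorm _).trans ?_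
        gcongr
        exact (hnorm _ huh t ht).trans (by norm_num)
      have hAh : ‖A x h (y t)‖ ≤ C * ‖h‖ * M :=
        ((A x).le_opNorm₂ h (y t)).trans (by gcongr)
      have e2 : ‖t • A x h (A x h (y t))‖ ≤ C * ‖h‖ * (C * ‖h‖ * M) := by
        rw [norm_smul, Real.norm_of_nonneg ht.1]
        refine (mul_le_of_le_one_left (norm_nonneg _) ht.2).trans ?_
        exact ((A x).le_opNorm₂ h _).trans (by gcongr)
      have e3 : ‖R u (y t)‖ ≤ C * (‖h‖ * ‖h‖) * ρ * M :=
        (R.le_opNorm₂ u (y t)).trans (by gcongr)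
      have e4 : ‖D h (y t)‖ ≤ C * ‖h‖ * ‖h‖ * M :=
        (D.le_opNorm₂ h (y t)).trans (by gcongr)
      have e5 : ‖t • D (u + h) (A x h (y t))‖ ≤ C * ‖h‖ * ρ * (C * ‖h‖ * M) := by
        rw [norm_smul, Real.norm_of_nonneg ht.1]
        refine (mul_le_of_le_one_left (norm_nonneg _) ht.2).trans ?_
        exact (D.le_opNorm₂ _ _).trans (by gcongr)
      refine (norm_add_le _ _).trans (add_le_add e1 ?_)
      refine ((norm_add_le _ _).trans (add_le_add ((norm_add_le _ _).trans
        (add_le_add ((norm_add_le _ _).trans (add_le_add e2 e3)) e4)) e5)).trans (le_of_eq ?_)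
      ring
  refine ⟨ρ, hρ, hsub.trans hballU, fun x => y (x - x₀) 1, ?_, fun x hx => ?_⟩
  -- The ray for u = 0 stays at `x₀` and its equation has right-hand side zero, so its solution is
  -- constant.
  · have h0 : ‖(0 : X)‖ < ρ := by simpa
    obtain ⟨hy0, hy', -⟩ := hy 0 h0
    have := norm_le_gronwallBound_of_norm_deriv_right_le (f := fun t => y 0 t - y₀)
      (f' := fun _ => 0) (δ := 0) (K := 1) (ε := 0) (a := 0) (b := 1)
      (fun t ht => ((hy' t ht).sub_const y₀).continuousWithinAt)
      (fun t ht => by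
        have := (hy' t ⟨ht.1, ht.2.le⟩).mono_of_mem_nhdsWithin (Icc_mem_nhdsGE_of_mem ht)
        simpa using this.sub_const y₀)
      (by simp [hy0]) (fun t ht => by simp) 1 (by simp)
    rw [gronwallBound_ε0_δ0] at this
    simpa [sub_eq_zero] using this
  · have hu : ‖x - x₀‖ < ρ := by simpa [dist_eq_norm] using hx
    rw [hasFDerivAt_iff_isLittleO_nhds_zero]
    refine Asymptotics.IsBigO.trans_isLittleO (g := fun h : X => ‖h‖ * ‖h‖) ?_ ?_
    · refine Asymptotics.IsBigO.of_bound ((C * C + C * ρ + C + C * C * ρ) * M * Real.exp 1) ?_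
      have hev : ∀ᶠ h in nhds (0 : X), ‖x - x₀ + h‖ < ρ ∧ ‖h‖ ≤ ρ := by
        refine Filter.Eventually.and ?_ ?_
        · have : ContinuousAt (fun h : X => ‖x - x₀ + h‖) 0 := by fun_prop
          exact this.eventually (gt_mem_nhds (by simpa using hu))
        · have : ContinuousAt (fun h : X => ‖h‖) 0 := by fun_prop
          exact (this.eventually (gt_mem_nhds (by simpa using hρ))).mono fun h hh => hh.le
      filter_upwards [hev] with h hh
      have := key (x - x₀) hu h hh.1 hh.2
      rw [Real.norm_of_nonneg (by positivity)]
      simpa [add_sub_right_comm] using this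
    · have : (fun h : X => ‖h‖ * ‖h‖) =o[nhds 0] fun h : X => (1 : ℝ) * ‖h‖ :=
        Asymptotics.IsLittleO.mul_isBigO
          ((Asymptotics.isLittleO_one_iff ℝ).2 (by simpa using (continuous_norm (E := X)).tendsto 0))
          (Asymptotics.isBigO_refl _ _)
      simp only [one_mul] at this
      exact this.trans_isBigO (Asymptotics.isBigO_norm_left.2 (Asymptotics.isBigO_refl _ _))

open Set Metric in
-- Grönwall along short segments shows that a zero of `D` has a neighbourhood of zeros; continuity
-- makes the zero set relatively closed, and connectedness finishes. Every uniqueness statement on a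
-- connected `V` rests on this.
theorem eqOn_zero_of_norm_fderiv_le {X E : Type*} [NormedAddCommGroup X] [NormedSpace ℝ X]
    [NormedAddCommGroup E] [NormedSpace ℝ E] {V : Set X} (hV : IsOpen V) (hVc : IsPreconnected V)
    {D : X → E} {K : X → ℝ} (hD : ∀ x ∈ V, DifferentiableAt ℝ D x) (hK : ContinuousOn K V)
    (hle : ∀ x ∈ V, ‖fderiv ℝ D x‖ ≤ K x * ‖D x‖) {x₀ : X} (hx₀ : x₀ ∈ V) (h0 : D x₀ = 0) :
    ∀ x ∈ V, D x = 0 := by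
  have hloc : ∀ a ∈ V, D a = 0 → ∀ᶠ x in nhds a, D x = 0 := by
    intro a ha hDa
    have hKa : ∀ᶠ x in nhds a, K x < K a + 1 :=
      ((hK a ha).continuousAt (hV.mem_nhds ha)).eventually (gt_mem_nhds (lt_add_one _))
    obtain ⟨ρ, hρ, hball⟩ := Metric.mem_nhds_iff.1 (Filter.inter_mem (hV.mem_nhds ha) hKa)
    filter_upwards [ball_mem_nhds a hρ] with x hx
    have hseg : ∀ t ∈ Icc (0 : ℝ) 1, a + t • (x - a) ∈ ball a ρ := by
      intro t ht
      rw [mem_ball, dist_eq_norm, add_sub_cancel_left, norm_smul, Real.norm_of_nonneg ht.1]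
      calc t * ‖x - a‖ ≤ 1 * ‖x - a‖ := by gcongr; exact ht.2
        _ < ρ := by simpa [dist_eq_norm] using hx
    have hline : ∀ t : ℝ, HasDerivAt (fun t : ℝ => a + t • (x - a)) (x - a) t := fun t => by
      simpa using ((hasDerivAt_id t).smul_const (x - a)).const_add a
    have hd : ∀ t ∈ Icc (0 : ℝ) 1, HasDerivAt (fun t : ℝ => D (a + t • (x - a)))
        (fderiv ℝ D (a + t • (x - a)) (x - a)) t := fun t ht =>
      HasFDerivAt.comp_hasDerivAt (l := D) (f := fun t : ℝ => a + t • (x - a)) t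
        (hD _ (hball (hseg t ht)).1).hasFDerivAt (hline t)
    have := eq_zero_of_abs_deriv_le_mul_abs_self_of_eq_zero_right
      (K := (K a + 1) * ‖x - a‖) (a := 0) (b := 1)
      (fun t ht => (hd t ht).continuousAt.continuousWithinAt)
      (fun t ht => (hd t ⟨ht.1, ht.2.le⟩).hasDerivWithinAt) (by simp [hDa])
      (fun t ht => by
        have hm := hball (hseg t ⟨ht.1, ht.2.le⟩)
        calc ‖fderiv ℝ D (a + t • (x - a)) (x - a)‖
            ≤ ‖fderiv ℝ D (a + t • (x - a))‖ * ‖x - a‖ := ContinuousLinearMap.le_opNorm _ _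
          _ ≤ ((K a + 1) * ‖D (a + t • (x - a))‖) * ‖x - a‖ := by
              gcongr
              refine (hle _ hm.1).trans ?_
              gcongr
              exact hm.2.le
          _ = _ := by ring) 1 (by simp)
    simpa using this
  intro x hx
  have hS : IsOpen {x | ∀ᶠ y in nhds x, D y = 0} := isOpen_setOfPred_eventually_nhds
  refine (hVc.subset_of_closure_inter_subset hS ⟨x₀, hx₀, hloc x₀ hx₀ h0⟩ ?_ hx).self_of_nhds
  rintro a ⟨hcl, haV⟩
  refine hloc a haV ?_
  by_contra hne
  have hev : ∀ᶠ y in nhds a, D y ≠ 0 := (hD a haV).continuousAt.eventually_ne hne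
  obtain ⟨b, hb1, hb2⟩ := mem_closure_iff_nhds.1 hcl _ hev
  exact hb1 hb2.self_of_nhds

/-! ### Calculus of partial derivatives in coordinates. -/

namespace PotentialSubmanifold

variable {N : ℕ} {E F : Type*} [NormedAddCommGroup E] [NormedSpace ℝ E]
  [NormedAddCommGroup F] [NormedSpace ℝ F]

theorem fderiv_apply_eq_sum_pd (f : Coord N → E) (u h : Coord N) :
    fderiv ℝ f u h = ∑ i, h i • pd i f u := by
  conv_lhs => rw [pi_eq_sum_univ' h]
  simp only [map_sum, map_smul, pd]

theorem norm_fderiv_le_of_norm_pd_le {f : Coord N → E} {u : Coord N} {K : ℝ}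
    (h : ∀ i, ‖pd i f u‖ ≤ K) (hK : 0 ≤ K) : ‖fderiv ℝ f u‖ ≤ N * K := by
  refine ContinuousLinearMap.opNorm_le_bound _ (by positivity) fun v => ?_
  rw [fderiv_apply_eq_sum_pd]
  calc ‖∑ i, v i • pd i f u‖ ≤ ∑ i : Fin N, ‖v‖ * K := by
        refine (norm_sum_le _ _).trans (Finset.sum_le_sum fun i _ => ?_)
        rw [norm_smul]
        gcongr
        · exact norm_le_pi_norm v i
        · exact h i
    _ = N * K * ‖v‖ := by simp; ring

theorem eqOn_zero_of_norm_pd_le {V : Set (Coord N)} (hV : IsOpen V) (hVc : IsPreconnected V)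
    {D : Coord N → E} {K : Coord N → ℝ} (hD : ContDiffOn ℝ ∞ D V) (hK : ContinuousOn K V)
    (hle : ∀ u ∈ V, ∀ i, ‖pd i D u‖ ≤ K u * ‖D u‖) {u₀ : Coord N} (hu₀ : u₀ ∈ V)
    (h0 : D u₀ = 0) : ∀ u ∈ V, D u = 0 := by
  refine eqOn_zero_of_norm_fderiv_le hV hVc (K := fun u => N * |K u|)
    (fun u hu => (hD.contDiffAt (hV.mem_nhds hu)).differentiableAt (by simp))
    (by fun_prop) (fun u hu => ?_) hu₀ h0
  rw [mul_assoc]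
  exact norm_fderiv_le_of_norm_pd_le (fun i => (hle u hu i).trans (by gcongr; exact le_abs_self _))
    (by positivity)

section Calculus

variable {U : Set (Coord N)}

theorem differentiableAt_of_contDiffOn (hU : IsOpen U) {f : Coord N → E}
    (hf : ContDiffOn ℝ ∞ f U) {u : Coord N} (hu : u ∈ U) : DifferentiableAt ℝ f u :=
  (hf.contDiffAt (hU.mem_nhds hu)).differentiableAt (by simp)

theorem contDiffOn_pd (hU : IsOpen U) {f : Coord N → E} (hf : ContDiffOn ℝ ∞ f U) (i : Fin N) :
    ContDiffOn ℝ ∞ (pd i f) U :=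
  ((contDiffOn_infty_iff_fderiv_of_isOpen hU).1 hf).2.clm_apply contDiffOn_const

theorem contDiffOn_third (hU : IsOpen U) {Φ : Coord N → ℝ} (hΦ : ContDiffOn ℝ ∞ Φ U)
    (i j k : Fin N) : ContDiffOn ℝ ∞ (third Φ i j k) U :=
  contDiffOn_pd hU (contDiffOn_pd hU (contDiffOn_pd hU hΦ k) j) i

theorem pd_congr (hU : IsOpen U) {f g : Coord N → E} (h : ∀ u ∈ U, f u = g u) {u : Coord N}
    (hu : u ∈ U) (i : Fin N) : pd i f u = pd i g u := by
  rw [pd, pd, Filter.EventuallyEq.fderiv_eq]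
  filter_upwards [hU.mem_nhds hu] with x hx using h x hx

theorem pd_comm (hU : IsOpen U) {f : Coord N → E} (hf : ContDiffOn ℝ ∞ f U) {u : Coord N}
    (hu : u ∈ U) (i j : Fin N) : pd i (pd j f) u = pd j (pd i f) u := by
  have hsymm : IsSymmSndFDerivAt ℝ f u :=
    (hf.contDiffAt (hU.mem_nhds hu)).isSymmSndFDerivAt
      (by simp only [minSmoothness_of_isRCLikeNormedField]; exact WithTop.coe_le_coe.2 le_top)
  have hd : DifferentiableAt ℝ (fderiv ℝ f) u :=
    (((contDiffOn_infty_iff_fderiv_of_isOpen hU).1 hf).2.contDiffAt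
      (hU.mem_nhds hu)).differentiableAt (by simp)
  have key : ∀ v w : Coord N, fderiv ℝ (fun x => fderiv ℝ f x w) u v
      = fderiv ℝ (fderiv ℝ f) u v w := fun v w => by
    rw [fderiv_clm_apply hd (by fun_prop)]
    simp
  change fderiv ℝ (fun x => fderiv ℝ f x _) u _ = fderiv ℝ (fun x => fderiv ℝ f x _) u _
  rw [key, key]
  exact hsymm _ _

/-- Together with `third_comm₂₃` this generates the full symmetry of Φ_ijk. -/
theorem third_comm₁₂ (hU : IsOpen U) {Φ : Coord N → ℝ} (hΦ : ContDiffOn ℝ ∞ Φ U) {u : Coord N}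
    (hu : u ∈ U) (i j k : Fin N) : third Φ i j k u = third Φ j i k u :=
  pd_comm hU (contDiffOn_pd hU hΦ k) hu i j

theorem third_comm₂₃ (hU : IsOpen U) {Φ : Coord N → ℝ} (hΦ : ContDiffOn ℝ ∞ Φ U) {u : Coord N}
    (hu : u ∈ U) (i j k : Fin N) : third Φ i j k u = third Φ i k j u :=
  pd_congr hU (fun _ hx => pd_comm hU hΦ hx j k) hu i

theorem pd_third_comm (hU : IsOpen U) {Φ : Coord N → ℝ} (hΦ : ContDiffOn ℝ ∞ Φ U) {u : Coord N}
    (hu : u ∈ U) (m i j k : Fin N) : pd m (third Φ i j k) u = pd i (third Φ m j k) u :=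
  pd_comm hU (contDiffOn_pd hU (contDiffOn_pd hU hΦ k) j) hu m i

theorem pd_clm_comp (L : E →L[ℝ] F) {f : Coord N → E} {u : Coord N}
    (hf : DifferentiableAt ℝ f u) (i : Fin N) : pd i (fun x => L (f x)) u = L (pd i f u) := by
  have h : HasFDerivAt (fun x => L (f x)) _ u := L.hasFDerivAt.comp u hf.hasFDerivAt
  rw [pd, pd, h.fderiv]
  rfl

theorem pd_const (c : E) (i : Fin N) (u : Coord N) : pd i (fun _ => c) u = 0 := by
  simp [pd]

theorem pd_add {f g : Coord N → E} {u : Coord N} (hf : DifferentiableAt ℝ f u)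
    (hg : DifferentiableAt ℝ g u) (i : Fin N) :
    pd i (fun x => f x + g x) u = pd i f u + pd i g u := by
  simp [pd, fderiv_fun_add hf hg]

theorem pd_sub {f g : Coord N → E} {u : Coord N} (hf : DifferentiableAt ℝ f u)
    (hg : DifferentiableAt ℝ g u) (i : Fin N) :
    pd i (fun x => f x - g x) u = pd i f u - pd i g u := by
  simp [pd, fderiv_fun_sub hf hg]

theorem pd_neg (f : Coord N → E) (i : Fin N) (u : Coord N) :
    pd i (fun x => -f x) u = -pd i f u := by
  simp [pd]

theorem pd_sum {ι : Type*} {s : Finset ι} {f : ι → Coord N → E} {u : Coord N}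
    (hf : ∀ a ∈ s, DifferentiableAt ℝ (f a) u) (i : Fin N) :
    pd i (fun x => ∑ a ∈ s, f a x) u = ∑ a ∈ s, pd i (f a) u := by
  simp [pd, fderiv_fun_sum hf]

theorem pd_const_smul {f : Coord N → E} {u : Coord N} (hf : DifferentiableAt ℝ f u) (c : ℝ)
    (i : Fin N) : pd i (fun x => c • f x) u = c • pd i f u := by
  simp [pd, fderiv_fun_const_smul hf]

theorem pd_smul {f : Coord N → ℝ} {g : Coord N → E} {u : Coord N} (hf : DifferentiableAt ℝ f u)
    (hg : DifferentiableAt ℝ g u) (i : Fin N) :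
    pd i (fun x => f x • g x) u = pd i f u • g u + f u • pd i g u := by
  simp [pd, fderiv_fun_smul hf hg, add_comm]

theorem pd_smul_const {f : Coord N → ℝ} {u : Coord N} (hf : DifferentiableAt ℝ f u) (v : E)
    (i : Fin N) : pd i (fun x => f x • v) u = pd i f u • v := by
  rw [pd_smul hf (by fun_prop), pd_const, smul_zero, add_zero]

theorem pd_apply {ι : Type*} [Fintype ι] {f : Coord N → ι → E} {u : Coord N}
    (hf : DifferentiableAt ℝ f u) (i : Fin N) (a : ι) :
    pd i f u a = pd i (fun x => f x a) u :=
  (pd_clm_comp (ContinuousLinearMap.proj (R := ℝ) (φ := fun _ : ι => E) a) hf i).symm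

theorem pd_pi {ι : Type*} [Fintype ι] {f : Coord N → ι → E} {u : Coord N}
    (hf : ∀ a, DifferentiableAt ℝ (fun x => f x a) u) (i : Fin N) :
    pd i f u = fun a => pd i (fun x => f x a) u := by
  ext a
  exact pd_apply (differentiableAt_pi.2 hf) i a

theorem pd_prodMk {f : Coord N → E} {g : Coord N → F} {u : Coord N} (hf : DifferentiableAt ℝ f u)
    (hg : DifferentiableAt ℝ g u) (i : Fin N) :
    pd i (fun x => (f x, g x)) u = (pd i f u, pd i g u) := by
  simp [pd, hf.fderiv_prodMk hg]

theorem pd_bilin [FiniteDimensional ℝ E] (G : LinearMap.BilinForm ℝ E) {f g : Coord N → E}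
    {u : Coord N} (hf : DifferentiableAt ℝ f u) (hg : DifferentiableAt ℝ g u) (i : Fin N) :
    pd i (fun x => G (f x) (g x)) u = G (pd i f u) (g u) + G (f u) (pd i g u) := by
  have h : HasFDerivAt (fun x => G (f x) (g x)) _ u :=
    G.toContinuousBilinearMap.hasFDerivAt_of_bilinear hf.hasFDerivAt hg.hasFDerivAt
  rw [pd, h.fderiv]
  simp [pd, add_comm]

theorem contDiffOn_bilin [FiniteDimensional ℝ E] (G : LinearMap.BilinForm ℝ E)
    {f g : Coord N → E} (hf : ContDiffOn ℝ ∞ f U) (hg : ContDiffOn ℝ ∞ g U) :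
    ContDiffOn ℝ ∞ (fun x => G (f x) (g x)) U :=
  (G.toContinuousBilinearMap.isBoundedBilinearMap.contDiff.comp_contDiffOn (hf.prodMk hg) :)

end Calculus

/-! ### Frobenius' theorem and the Poincaré lemma in coordinates. -/

open Metric in
/-- Frobenius' theorem for linear systems `∂ᵢY = Aᵢ Y`. -/
theorem exists_solution_linear_system [FiniteDimensional ℝ E] {U : Set (Coord N)}
    (hU : IsOpen U) {A : Fin N → Coord N → E →ₗ[ℝ] E}
    (hA : ∀ i y, ContDiffOn ℝ ∞ (fun u => A i u y) U)
    (hflat : ∀ u ∈ U, ∀ i j y, pd i (fun x => A j x y) u + A j u (A i u y) =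
      pd j (fun x => A i x y) u + A i u (A j u y))
    {u₀ : Coord N} (hu₀ : u₀ ∈ U) (y₀ : E) :
    ∃ ρ > 0, ball u₀ ρ ⊆ U ∧ ∃ Y : Coord N → E, ContDiffOn ℝ ∞ Y (ball u₀ ρ) ∧ Y u₀ = y₀ ∧
      ∀ u ∈ ball u₀ ρ, ∀ i, pd i Y u = A i u (Y u) := by
  have := FiniteDimensional.complete ℝ E
  -- The operators A_i are packed into one operator-valued 1-form h ↦ ∑ hⁱ A_i, to which the
  -- coordinate-free theorem applies.
  let B : Coord N → Coord N →L[ℝ] E →L[ℝ] E := fun u =>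
    ∑ i, (ContinuousLinearMap.proj (R := ℝ) (φ := fun _ : Fin N => ℝ) i).smulRight
      (LinearMap.toContinuousLinearMap (A i u))
  have hBapp : ∀ u h y, B u h y = ∑ i, h i • A i u y := fun u h y => by
    simp [B]
  have hB : ContDiffOn ℝ ∞ B U := by
    rw [contDiffOn_clm_apply]
    intro h
    rw [contDiffOn_clm_apply]
    intro y
    simp only [hBapp]
    exact ContDiffOn.sum fun i _ => contDiffOn_const.smul (hA i y)
  have hdA : ∀ u ∈ U, ∀ i y, DifferentiableAt ℝ (fun x => A i x y) u := fun u hu i y =>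
    differentiableAt_of_contDiffOn hU (hA i y) hu
  have hfd : ∀ u ∈ U, ∀ h k y, fderiv ℝ B u h k y =
      ∑ i, ∑ j, (h i * k j) • pd i (fun x => A j x y) u := by
    intro u hu h k y
    have hBu := (differentiableAt_of_contDiffOn hU hB hu).hasFDerivAt
    have h2 : fderiv ℝ B u h k y = fderiv ℝ (fun x => B x k y) u h := by
      rw [((hBu.clm_apply (hasFDerivAt_const k u)).clm_apply (hasFDerivAt_const y u)).fderiv]
      simp
    rw [h2, fderiv_apply_eq_sum_pd]
    refine Finset.sum_congr rfl fun i _ => ?_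
    simp only [hBapp]
    rw [pd_sum fun j _ => (hdA u hu j y).fun_const_smul (k j), Finset.smul_sum]
    refine Finset.sum_congr rfl fun j _ => ?_
    rw [pd_const_smul (hdA u hu j y), smul_smul]
  obtain ⟨ρ, hρ, hball, Y, hY0, hY⟩ := exists_hasFDerivAt_of_flat hU hB (fun u hu h k y => by
    have h1 : ∀ h k : Coord N, B u k (B u h y) = ∑ i, ∑ j, (h i * k j) • A j u (A i u y) := by
      intro h k
      rw [Finset.sum_comm]
      simp only [hBapp, map_sum, map_smul, Finset.smul_sum, smul_smul]
      simp only [mul_comm]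
    rw [hfd u hu, hfd u hu, h1, h1]
    conv_rhs => rw [Finset.sum_comm]; enter [2]; rw [Finset.sum_comm]
    simp only [← Finset.sum_add_distrib]
    refine Finset.sum_congr rfl fun i _ => Finset.sum_congr rfl fun j _ => ?_
    rw [mul_comm (k j), ← smul_add, ← smul_add, hflat u hu]) hu₀ y₀
  refine ⟨ρ, hρ, hball, Y, ?_, hY0, fun u hu i => ?_⟩
  -- Bootstrapping: if `Y` is of class Cⁿ, then so is its derivative, which is `B` applied to `Y`;
  -- hence `Y` is of class Cⁿ⁺¹.
  · rw [contDiffOn_infty]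
    intro n
    induction n with
    | zero =>
      rw [Nat.cast_zero, contDiffOn_zero]
      exact fun u hu => (hY u hu).continuousAt.continuousWithinAt
    | succ n ih =>
      rw [Nat.cast_succ, contDiffOn_succ_iff_fderiv_of_isOpen isOpen_ball]
      refine ⟨fun u hu => (hY u hu).differentiableAt.differentiableWithinAt,
        fun h => absurd h (by simp), ?_⟩
      refine ContDiffOn.congr (f := fun u => (B u).flip (Y u)) ?_ fun u hu => (hY u hu).fderiv
      rw [contDiffOn_clm_apply]
      intro h
      exact (((hB.mono hball).of_le (by exact_mod_cast le_top)).clm_apply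
        contDiffOn_const).clm_apply ih
  · rw [pd, (hY u hu).fderiv, ContinuousLinearMap.flip_apply, hBapp]
    simp [Pi.single_apply]

open Metric in
/-- The Poincaré lemma for closed `1`-forms. -/
theorem exists_primitive_of_closed [FiniteDimensional ℝ E] {U : Set (Coord N)} (hU : IsOpen U)
    {a : Fin N → Coord N → E} (ha : ∀ i, ContDiffOn ℝ ∞ (a i) U)
    (hclosed : ∀ u ∈ U, ∀ i j, pd i (a j) u = pd j (a i) u) {u₀ : Coord N} (hu₀ : u₀ ∈ U) :
    ∃ ρ > 0, ball u₀ ρ ⊆ U ∧ ∃ f : Coord N → E, ContDiffOn ℝ ∞ f (ball u₀ ρ) ∧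
      ∀ u ∈ ball u₀ ρ, ∀ i, pd i f u = a i u := by
  have hd := fun u hu i => differentiableAt_of_contDiffOn hU (ha i) (u := u) hu
  -- The inhomogeneous equation ∂_i f = a_i is made linear by an auxiliary scalar s with ∂_i s = 0
  -- and ∂_i f = s a_i. Starting from s = 1, the scalar stays 1, which is `h1`.
  obtain ⟨ρ, hρ, hball, Y, hYs, hY0, hY⟩ := exists_solution_linear_system (E := ℝ × E) hU
    (A := fun i u => (LinearMap.inr ℝ ℝ E).comp ((LinearMap.fst ℝ ℝ E).smulRight (a i u)))
    (fun i y => contDiffOn_const.prodMk (contDiffOn_const.smul (ha i)))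
    (fun u hu i j y => by
      have : ∀ i j, pd i (fun x => ((0 : ℝ), y.1 • a j x)) u = (0, y.1 • pd i (a j) u) :=
        fun i j => by
          rw [pd_prodMk (by fun_prop) ((hd u hu j).fun_const_smul _), pd_const,
            pd_const_smul (hd u hu j)]
      simpa [this] using congrArg (y.1 • ·) (hclosed u hu i j)) hu₀ (1, 0)
  have hYd := fun u hu => differentiableAt_of_contDiffOn isOpen_ball hYs (u := u) hu
  have h1 : ∀ u ∈ ball u₀ ρ, (Y u).1 - 1 = 0 := by
    refine eqOn_zero_of_norm_pd_le isOpen_ball (convex_ball u₀ ρ).isPreconnected (K := fun _ => 0)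
      (hYs.fst.sub contDiffOn_const) continuousOn_const (fun u hu i => ?_) (mem_ball_self hρ)
      (by simp [hY0])
    have := pd_clm_comp (ContinuousLinearMap.fst ℝ ℝ E) (hYd u hu) i
    rw [pd_sub (hYd u hu).fst (by fun_prop), pd_const]
    simp only [ContinuousLinearMap.coe_fst'] at this
    simp [this, hY u hu]
  refine ⟨ρ, hρ, hball, fun u => (Y u).2, hYs.snd, fun u hu i => ?_⟩
  have := pd_clm_comp (ContinuousLinearMap.snd ℝ ℝ E) (hYd u hu) i
  simp only [ContinuousLinearMap.coe_snd'] at this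
  rw [this, hY u hu]
  simp [sub_eq_zero.1 (h1 u hu)]

end PotentialSubmanifold

namespace PotentialSubmanifold

variable {N : ℕ} {E F : Type*} [NormedAddCommGroup E] [NormedSpace ℝ E]
  [NormedAddCommGroup F] [NormedSpace ℝ F]

theorem eqOn_of_linear_system [FiniteDimensional ℝ E] {V : Set (Coord N)} (hV : IsOpen V)
    (hVc : IsPreconnected V) {A : Fin N → Coord N → E →ₗ[ℝ] E}
    (hA : ∀ i y, ContDiffOn ℝ ∞ (fun u => A i u y) V) {Y Z : Coord N → E}
    (hYs : ContDiffOn ℝ ∞ Y V) (hZs : ContDiffOn ℝ ∞ Z V)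
    (hY : ∀ u ∈ V, ∀ i, pd i Y u = A i u (Y u)) (hZ : ∀ u ∈ V, ∀ i, pd i Z u = A i u (Z u))
    {u₀ : Coord N} (hu₀ : u₀ ∈ V) (h0 : Y u₀ = Z u₀) : ∀ u ∈ V, Y u = Z u := by
  have hB : ∀ i, ContDiffOn ℝ ∞ (fun u => LinearMap.toContinuousLinearMap (A i u)) V := fun i => by
    rw [contDiffOn_clm_apply]
    exact fun y => hA i y
  have := eqOn_zero_of_norm_pd_le hV hVc (D := fun u => Y u - Z u)
    (K := fun u => ∑ i, ‖LinearMap.toContinuousLinearMap (A i u)‖) (hYs.sub hZs)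
    (continuousOn_finsetSum _ fun i _ => (hB i).continuousOn.norm) (fun u hu i => by
      rw [pd_sub (differentiableAt_of_contDiffOn hV hYs hu) (differentiableAt_of_contDiffOn hV hZs hu),
        hY u hu, hZ u hu, ← map_sub]
      refine ((LinearMap.toContinuousLinearMap (A i u)).le_opNorm _).trans ?_
      gcongr
      exact Finset.single_le_sum (f := fun i => ‖LinearMap.toContinuousLinearMap (A i u)‖)
        (fun i _ => norm_nonneg _) (Finset.mem_univ i)) hu₀ (by simp [h0])
  exact fun u hu => sub_eq_zero.1 (this u hu)

theorem eqOn_add_const_of_pd_eq {V : Set (Coord N)} (hV : IsOpen V) (hVc : IsPreconnected V)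
    {f g : Coord N → E} (hf : ContDiffOn ℝ ∞ f V) (hg : ContDiffOn ℝ ∞ g V)
    (h : ∀ u ∈ V, ∀ i, pd i f u = pd i g u) {u₀ : Coord N} (hu₀ : u₀ ∈ V) :
    ∀ u ∈ V, f u = g u + (f u₀ - g u₀) := by
  have := eqOn_zero_of_norm_pd_le hV hVc (D := fun u => f u - g u - (f u₀ - g u₀))
    (K := fun _ => 0) ((hf.sub hg).sub contDiffOn_const) continuousOn_const (fun u hu i => by
      have hfd := differentiableAt_of_contDiffOn hV hf hu
      have hgd := differentiableAt_of_contDiffOn hV hg hu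
      rw [pd_sub (hfd.fun_sub hgd) (by fun_prop), pd_sub hfd hgd, h u hu, pd_const]
      simp) hu₀ (by simp)
  intro u hu
  rw [← sub_eq_iff_eq_add', ← sub_eq_zero]
  exact this u hu

/-! ### The structural functions and forms of the associativity equations. -/

section Coeff

/-- The structural functions `η^{kl} Φ_{ijk}`. -/
noncomputable def coeff (η : Matrix (Fin N) (Fin N) ℝ) (Φ : Coord N → ℝ) (l i j : Fin N)
    (u : Coord N) : ℝ :=
  ∑ k, η⁻¹ k l * third Φ i j k u

variable {η : Matrix (Fin N) (Fin N) ℝ} {Φ : Coord N → ℝ} {U : Set (Coord N)}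

theorem sum_sum_smul_eq_sum_coeff_smul (i j : Fin N) (u : Coord N) (v : Fin N → E) :
    ∑ k, ∑ l, (η⁻¹ k l * third Φ i j k u) • v l = ∑ l, coeff η Φ l i j u • v l := by
  rw [Finset.sum_comm]
  simp [coeff, Finset.sum_smul]

theorem contDiffOn_coeff (hU : IsOpen U) (hΦ : ContDiffOn ℝ ∞ Φ U) (l i j : Fin N) :
    ContDiffOn ℝ ∞ (coeff η Φ l i j) U :=
  ContDiffOn.sum fun k _ => contDiffOn_const.mul (contDiffOn_third hU hΦ i j k)

theorem coeff_comm (hU : IsOpen U) (hΦ : ContDiffOn ℝ ∞ Φ U) {u : Coord N} (hu : u ∈ U)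
    (l i j : Fin N) : coeff η Φ l i j u = coeff η Φ l j i u := by
  simp only [coeff, third_comm₁₂ hU hΦ hu i j]

theorem pd_coeff_comm (hU : IsOpen U) (hΦ : ContDiffOn ℝ ∞ Φ U) {u : Coord N} (hu : u ∈ U)
    (m l i j : Fin N) : pd m (coeff η Φ l i j) u = pd i (coeff η Φ l m j) u := by
  have h : ∀ m i : Fin N, pd m (coeff η Φ l i j) u = ∑ k, η⁻¹ k l * pd m (third Φ i j k) u := by
    intro m i
    have hd := fun k => differentiableAt_of_contDiffOn hU (contDiffOn_third hU hΦ i j k) hu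
    have := pd_sum (s := Finset.univ) (f := fun k x => η⁻¹ k l • third Φ i j k x)
      (fun k _ => (hd k).fun_const_smul (η⁻¹ k l)) m
    simp only [pd_const_smul (hd _)] at this
    exact this
  rw [h, h]
  exact Finset.sum_congr rfl fun k _ => by rw [pd_third_comm hU hΦ hu]

theorem inv_mul_cancel_sum (hη : IsMetricMatrix η) (k m : Fin N) :
    ∑ l, η⁻¹ k l * η l m = if k = m then 1 else 0 := by
  have := congrFun (congrFun (Matrix.nonsing_inv_mul η hη.2.isUnit) k) m
  rwa [Matrix.mul_apply, Matrix.one_apply] at this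

/-- Lowering the raised index undoes `η⁻¹`. This is the passage between the operator form and the
symmetric form of Φ_ijk. -/
theorem sum_coeff_mul_metric (hη : IsMetricMatrix η) (i j m : Fin N) (u : Coord N) :
    ∑ l, coeff η Φ l i j u * η l m = third Φ i j m u := by
  simp only [coeff, Finset.sum_mul]
  rw [Finset.sum_comm]
  have : ∀ k, ∑ l, η⁻¹ k l * third Φ i j k u * η l m = if k = m then third Φ i j k u else 0 := by
    intro k
    have := inv_mul_cancel_sum hη k m
    calc _ = (∑ l, η⁻¹ k l * η l m) * third Φ i j k u := by
          rw [Finset.sum_mul]; exact Finset.sum_congr rfl fun l _ => by ring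
      _ = _ := by rw [this]; simp
  simp [this]

theorem wdvv_iff_third : WDVV η Φ U ↔ ∀ u ∈ U, ∀ i j m n : Fin N,
    ∑ l, coeff η Φ l i j u * third Φ l m n u = ∑ l, coeff η Φ l i m u * third Φ l j n u := by
  have h : ∀ u (i j m n : Fin N), ∑ k, ∑ l, third Φ i j k u * η⁻¹ k l * third Φ l m n u =
      ∑ l, coeff η Φ l i j u * third Φ l m n u := by
    intro u i j m n
    rw [Finset.sum_comm]
    simp only [coeff, Finset.sum_mul]
    exact Finset.sum_congr rfl fun l _ => Finset.sum_congr rfl fun k _ => by ring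
  simp only [WDVV, h]

/-- Raising the free index n turns (W) into the commutation of the operators with matrices
η^{kl}Φ_{ijk}; nondegeneracy of η lets the index be lowered again. -/
theorem wdvv_iff_coeff (hη : IsMetricMatrix η) : WDVV η Φ U ↔ ∀ u ∈ U, ∀ i j m n : Fin N,
    ∑ l, coeff η Φ l i j u * coeff η Φ n l m u = ∑ l, coeff η Φ l i m u * coeff η Φ n l j u := by
  rw [wdvv_iff_third]
  have h1 : ∀ u (i j m n : Fin N), ∑ l, coeff η Φ l i j u * coeff η Φ n l m u =
      ∑ s, η⁻¹ s n * ∑ l, coeff η Φ l i j u * third Φ l m s u := by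
    intro u i j m n
    conv_lhs => enter [2, l]; rw [coeff.eq_1 η Φ n, Finset.mul_sum]
    rw [Finset.sum_comm]
    simp only [Finset.mul_sum]
    exact Finset.sum_congr rfl fun l _ => Finset.sum_congr rfl fun k _ => by ring
  have h2 : ∀ u (i j m n : Fin N), ∑ l, coeff η Φ l i j u * third Φ l m n u =
      ∑ s, (∑ l, coeff η Φ l i j u * coeff η Φ s l m u) * η s n := by
    intro u i j m n
    simp only [Finset.sum_mul]
    rw [Finset.sum_comm]
    simp only [mul_assoc, ← Finset.mul_sum, sum_coeff_mul_metric hη]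
  constructor
  · intro h u hu i j m n
    simp only [h1, h u hu]
  · intro h u hu i j m n
    simp only [h2, h u hu]

end Coeff

/-! ### The linear system (L): integrability and consistency. -/

section System

variable {η : Matrix (Fin N) (Fin N) ℝ} {c : ℝ} {Φ : Coord N → ℝ} {U V : Set (Coord N)}

/-- The operator `(p, q) ↦ (c Tˡ_i q_l, -Tˡ_i p_l)`. -/
def frameOperator (c : ℝ) (T : Fin N → Fin N → ℝ) :
    (Fin N → F) × (Fin N → F) →ₗ[ℝ] (Fin N → F) × (Fin N → F) where
  toFun y := (fun i => c • ∑ l, T l i • y.2 l, fun i => -∑ l, T l i • y.1 l)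
  map_add' y z := by
    ext i <;> simp [smul_add, Finset.sum_add_distrib, add_comm]
  map_smul' a y := by
    ext i <;> simp [Finset.smul_sum, smul_comm a]

theorem contDiffOn_frameOperator (hU : IsOpen U) (hΦ : ContDiffOn ℝ ∞ Φ U) (k : Fin N)
    (y : (Fin N → F) × (Fin N → F)) :
    ContDiffOn ℝ ∞ (fun u => frameOperator c (fun l i => coeff η Φ l k i u) y) U := by
  refine ContDiffOn.prodMk (contDiffOn_pi.2 fun i => ?_) (contDiffOn_pi.2 fun i => ?_)
  · exact contDiffOn_const.smul
      (ContDiffOn.sum fun l _ => (contDiffOn_coeff hU hΦ l k i).smul contDiffOn_const)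
  · exact (ContDiffOn.sum fun l _ => (contDiffOn_coeff hU hΦ l k i).smul contDiffOn_const).neg

theorem pd_frameOperator (hU : IsOpen U) (hΦ : ContDiffOn ℝ ∞ Φ U) {u : Coord N} (hu : u ∈ U)
    (m k : Fin N) (y : (Fin N → F) × (Fin N → F)) :
    pd m (fun u => frameOperator c (fun l i => coeff η Φ l k i u) y) u =
      frameOperator c (fun l i => pd m (coeff η Φ l k i) u) y := by
  have hd := fun l i => differentiableAt_of_contDiffOn hU (contDiffOn_coeff (η := η) hU hΦ l k i) hu
  have hsum : ∀ (v : Fin N → F) (i : Fin N), DifferentiableAt ℝ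
      (fun x => ∑ l, coeff η Φ l k i x • v l) u :=
    fun v i => DifferentiableAt.fun_sum fun l _ => (hd l i).smul_const _
  have hpd : ∀ (v : Fin N → F) (i : Fin N), pd m (fun x => ∑ l, coeff η Φ l k i x • v l) u =
      ∑ l, pd m (coeff η Φ l k i) u • v l := fun v i => by
    rw [pd_sum fun l _ => (hd l i).smul_const _]
    exact Finset.sum_congr rfl fun l _ => pd_smul_const (hd l i) _ m
  have := pd_prodMk (f := fun x i => c • ∑ l, coeff η Φ l k i x • y.2 l)
    (g := fun x i => -∑ l, coeff η Φ l k i x • y.1 l) (u := u)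
    (differentiableAt_pi.2 fun i => (hsum y.2 i).fun_const_smul c)
    (differentiableAt_pi.2 fun i => (hsum y.1 i).fun_neg) m
  refine this.trans ?_
  rw [pd_pi fun i => (hsum y.2 i).fun_const_smul c, pd_pi fun i => (hsum y.1 i).fun_neg]
  simp only [pd_const_smul (hsum _ _), pd_neg, hpd]
  rfl

/-- The derivative terms agree by symmetry of the fourth derivatives of Φ. Each composition acts as
-c times a product of two structural matrices on both blocks, so the quadratic terms agree because
(W) makes these matrices commute. -/
theorem frameOperator_flat (hη : IsMetricMatrix η) (hU : IsOpen U) (hΦ : ContDiffOn ℝ ∞ Φ U)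
    (hW : WDVV η Φ U) {u : Coord N} (hu : u ∈ U) (i j : Fin N) (y : (Fin N → F) × (Fin N → F)) :
    pd i (fun x => frameOperator c (fun l a => coeff η Φ l j a x) y) u +
        frameOperator c (fun l a => coeff η Φ l j a u)
          (frameOperator c (fun l a => coeff η Φ l i a u) y) =
      pd j (fun x => frameOperator c (fun l a => coeff η Φ l i a x) y) u +
        frameOperator c (fun l a => coeff η Φ l i a u)
          (frameOperator c (fun l a => coeff η Φ l j a u) y) := by
  rw [wdvv_iff_coeff hη] at hW
  rw [pd_frameOperator hU hΦ hu, pd_frameOperator hU hΦ hu]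
  simp only [pd_coeff_comm hU hΦ hu i _ j]
  congr 1
  have key : ∀ (a : Fin N) (v : Fin N → F),
      ∑ l, coeff η Φ l j a u • ∑ s, coeff η Φ s i l u • v s =
        ∑ l, coeff η Φ l i a u • ∑ s, coeff η Φ s j l u • v s := by
    intro a v
    simp only [Finset.smul_sum, smul_smul]
    rw [Finset.sum_comm, Finset.sum_comm (f := fun l s => (coeff η Φ l i a u * _) • v s)]
    simp only [← Finset.sum_smul]
    refine Finset.sum_congr rfl fun s _ => ?_
    congr 1
    have := hW u hu a j i s
    simpa only [coeff_comm hU hΦ hu _ a, coeff_comm hU hΦ hu s _ i,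
      coeff_comm hU hΦ hu s _ j] using this
  ext a
  · simpa [frameOperator] using congrArg (-(c • ·)) (key a y.1)
  · simpa [frameOperator, Finset.smul_sum, smul_comm c] using congrArg (-(c • ·)) (key a y.2)

theorem SolvesSystem.eq_r_coeff {r n : Coord N → Ambient N} (h : SolvesSystem η c Φ V r n)
    {u : Coord N} (hu : u ∈ V) (i j : Fin N) :
    pd i (pd j r) u = c • ∑ l, coeff η Φ l i j u • pd l n u := by
  rw [h.eq_r u hu, sum_sum_smul_eq_sum_coeff_smul]

theorem SolvesSystem.eq_n_coeff {r n : Coord N → Ambient N} (h : SolvesSystem η c Φ V r n)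
    {u : Coord N} (hu : u ∈ V) (i j : Fin N) :
    pd i (pd j n) u = -∑ l, coeff η Φ l i j u • pd l r u := by
  rw [h.eq_n u hu, sum_sum_smul_eq_sum_coeff_smul]

theorem exists_primitive_with_value [FiniteDimensional ℝ E] (hU : IsOpen U)
    {a : Fin N → Coord N → E} (ha : ∀ i, ContDiffOn ℝ ∞ (a i) U)
    (hclosed : ∀ u ∈ U, ∀ i j, pd i (a j) u = pd j (a i) u) {u₀ : Coord N} (hu₀ : u₀ ∈ U)
    (f₀ : E) : ∃ ρ > 0, Metric.ball u₀ ρ ⊆ U ∧ ∃ f : Coord N → E,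
      ContDiffOn ℝ ∞ f (Metric.ball u₀ ρ) ∧ f u₀ = f₀ ∧
      ∀ u ∈ Metric.ball u₀ ρ, ∀ i, pd i f u = a i u := by
  obtain ⟨ρ, hρ, hball, f, hf, hfa⟩ := exists_primitive_of_closed hU ha hclosed hu₀
  refine ⟨ρ, hρ, hball, fun u => f u + (f₀ - f u₀), hf.add contDiffOn_const, by simp,
    fun u hu i => ?_⟩
  rw [pd_add (differentiableAt_of_contDiffOn Metric.isOpen_ball hf hu) (by fun_prop), pd_const,
    add_zero, hfa u hu]

open Metric in
-- The first derivatives (r_i, n_i) are found from the flat first-order system. They are gradients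
-- because the structural functions are symmetric in their lower indices, so two further
-- integrations give r and n.
theorem exists_solvesSystem_ball (hη : IsMetricMatrix η) (hU : IsOpen U)
    (hΦ : ContDiffOn ℝ ∞ Φ U) (hW : WDVV η Φ U) {u₀ : Coord N} (hu₀ : u₀ ∈ U)
    (r₀ n₀ : Ambient N) (r₁ n₁ : Fin N → Ambient N) :
    ∃ ρ > 0, ball u₀ ρ ⊆ U ∧ ∃ r n : Coord N → Ambient N, SolvesSystem η c Φ (ball u₀ ρ) r n ∧
      r u₀ = r₀ ∧ n u₀ = n₀ ∧ (∀ i, pd i r u₀ = r₁ i) ∧ (∀ i, pd i n u₀ = n₁ i) := by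
  obtain ⟨ρ, hρ, hball, Y, hYs, hY0, hY⟩ := exists_solution_linear_system hU
    (A := fun k u => frameOperator c (fun l i => coeff η Φ l k i u))
    (contDiffOn_frameOperator hU hΦ) (fun u hu i j y => frameOperator_flat hη hU hΦ hW hu i j y)
    hu₀ (r₁, n₁)
  have hYd := fun u hu => differentiableAt_of_contDiffOn isOpen_ball hYs (u := u) hu
  have hp : ∀ u ∈ ball u₀ ρ, ∀ i j, pd i (fun x => (Y x).1 j) u =
      c • ∑ l, coeff η Φ l i j u • (Y u).2 l := by
    intro u hu i j
    have h1 := pd_clm_comp ((ContinuousLinearMap.proj (R := ℝ) (φ := fun _ => Ambient N) j).comp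
      (ContinuousLinearMap.fst ℝ (Fin N → Ambient N) (Fin N → Ambient N))) (hYd u hu) i
    rw [hY u hu i] at h1
    exact h1
  have hq : ∀ u ∈ ball u₀ ρ, ∀ i j, pd i (fun x => (Y x).2 j) u =
      -∑ l, coeff η Φ l i j u • (Y u).1 l := by
    intro u hu i j
    have h1 := pd_clm_comp ((ContinuousLinearMap.proj (R := ℝ) (φ := fun _ => Ambient N) j).comp
      (ContinuousLinearMap.snd ℝ (Fin N → Ambient N) (Fin N → Ambient N))) (hYd u hu) i
    rw [hY u hu i] at h1
    exact h1
  obtain ⟨ρ₁, hρ₁, hball₁, r, hrs, hr0, hr⟩ := exists_primitive_with_value isOpen_ball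
    (a := fun j x => (Y x).1 j) (fun j => contDiffOn_pi.1 hYs.fst j) (fun u hu i j => by
      simp only [hp u hu, coeff_comm hU hΦ (hball hu) _ i j]) (mem_ball_self hρ) r₀
  obtain ⟨ρ₂, hρ₂, hball₂, n, hns, hn0, hn⟩ := exists_primitive_with_value isOpen_ball
    (a := fun j x => (Y x).2 j) (fun j => contDiffOn_pi.1 hYs.snd j) (fun u hu i j => by
      simp only [hq u hu, coeff_comm hU hΦ (hball hu) _ i j]) (mem_ball_self hρ) n₀
  have hs₁ : ball u₀ (min ρ₁ ρ₂) ⊆ ball u₀ ρ₁ := ball_subset_ball (min_le_left _ _)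
  have hs₂ : ball u₀ (min ρ₁ ρ₂) ⊆ ball u₀ ρ₂ := ball_subset_ball (min_le_right _ _)
  refine ⟨min ρ₁ ρ₂, lt_min hρ₁ hρ₂, (hs₁.trans hball₁).trans hball, r, n,
    ⟨hrs.mono hs₁, hns.mono hs₂, fun u hu i j => ?_, fun u hu i j => ?_⟩, hr0, hn0,
    fun i => ?_, fun i => ?_⟩
  · rw [pd_congr isOpen_ball (fun x hx => hr x hx j) (hs₁ hu), hp u (hball₁ (hs₁ hu)),
      sum_sum_smul_eq_sum_coeff_smul]
    simp only [hn u (hs₂ hu)]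
  · rw [pd_congr isOpen_ball (fun x hx => hn x hx j) (hs₂ hu), hq u (hball₁ (hs₁ hu)),
      sum_sum_smul_eq_sum_coeff_smul]
    simp only [hr u (hs₁ hu)]
  · rw [hr u₀ (mem_ball_self hρ₁), hY0]
  · rw [hn u₀ (mem_ball_self hρ₂), hY0]

/-- Under exchange of `m` and `j` the terms in the derivatives of n are automatically symmetric; the
compatibility condition sits in the coefficients of the r_s. -/
theorem SolvesSystem.pd_pd_pd_r {r n : Coord N → Ambient N} (hU : IsOpen U)
    (hΦ : ContDiffOn ℝ ∞ Φ U) (hV : IsOpen V) (hVU : V ⊆ U) (h : SolvesSystem η c Φ V r n)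
    {u : Coord N} (hu : u ∈ V) (m j i : Fin N) :
    pd m (pd j (pd i r)) u = c • ∑ l, (pd m (coeff η Φ l j i) u • pd l n u -
      coeff η Φ l j i u • ∑ s, coeff η Φ s m l u • pd s r u) := by
  have hc := fun l => differentiableAt_of_contDiffOn hU
    (contDiffOn_coeff (η := η) hU hΦ l j i) (hVU hu)
  have hn := fun l => differentiableAt_of_contDiffOn hV (contDiffOn_pd hV h.smooth_n l) hu
  rw [pd_congr hV (fun x hx => h.eq_r_coeff hx j i) hu,
    pd_const_smul (DifferentiableAt.fun_sum fun l _ => (hc l).fun_smul (hn l)),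
    pd_sum fun l _ => (hc l).fun_smul (hn l)]
  simp only [pd_smul (hc _) (hn _), h.eq_n_coeff hu, smul_neg, sub_eq_add_neg]

theorem isConsistent_iff_wdvv (hη : IsMetricMatrix η) (hU : IsOpen U)
    (hΦ : ContDiffOn ℝ ∞ Φ U) (hc : c ≠ 0) : IsConsistent η c Φ U ↔ WDVV η Φ U := by
  refine ⟨fun h => ?_, fun hW u₀ hu₀ r₀ n₀ r₁ n₁ => ?_⟩
  · rw [wdvv_iff_coeff hη]
    intro u hu i j m s
    -- An index of type `Fin N` exists, so the ambient space has a coordinate at which the vector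
    -- identity can be evaluated.
    have hN : 0 < 2 * N := by have := i.pos; omega
    -- With r_s the only nonzero first derivative at u, the equality of mixed third derivatives of r
    -- reduces to the coefficients of r_s, which is the component of (W) with upper index s.
    obtain ⟨V, hV, huV, hVU, r, n, hs, -, -, hr, hn⟩ :=
      h u hu 0 0 (Pi.single s fun _ => 1) 0
    have hcomm := pd_comm hV (contDiffOn_pd hV hs.smooth_r i) huV m j
    rw [hs.pd_pd_pd_r hU hΦ hV hVU huV, hs.pd_pd_pd_r hU hΦ hV hVU huV] at hcomm
    have := congrFun (smul_right_injective _ hc hcomm) ⟨0, hN⟩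
    simp only [hr, hn, Pi.zero_apply, smul_zero, zero_sub, Finset.sum_neg_distrib, Pi.neg_apply,
      Finset.sum_apply, Pi.smul_apply, smul_eq_mul, neg_inj] at this
    have e : ∀ x : Fin N, (Pi.single s (fun _ => 1) : Fin N → Ambient N) x ⟨0, hN⟩ =
        if x = s then 1 else 0 := fun x => by
      by_cases hx : x = s
      · subst hx; simp
      · simp [hx]
    simp only [e, mul_ite, mul_one, mul_zero, Finset.sum_ite_eq', Finset.mem_univ, if_true] at this
    simpa only [coeff_comm hU hΦ hu _ i, coeff_comm hU hΦ hu s _ j,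
      coeff_comm hU hΦ hu s _ m] using this
  · obtain ⟨ρ, hρ, hball, H⟩ := exists_solvesSystem_ball (c := c) hη hU hΦ hW hu₀ r₀ n₀ r₁ n₁
    exact ⟨_, Metric.isOpen_ball, Metric.mem_ball_self hρ, hball, H⟩

end System

end PotentialSubmanifold

/-! ### Signatures and Sylvester's law of inertia. -/

namespace PotentialSubmanifold

variable {N : ℕ}

section Signature

variable {E E₁ E₂ : Type*} [AddCommGroup E] [Module ℝ E] [AddCommGroup E₁] [Module ℝ E₁]
  [AddCommGroup E₂] [Module ℝ E₂]

open QuadraticMap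

theorem signature_eq_of_isometry {G₁ : LinearMap.BilinForm ℝ E₁} {G₂ : LinearMap.BilinForm ℝ E₂}
    (e : E₁ ≃ₗ[ℝ] E₂) (he : ∀ x y, G₂ (e x) (e y) = G₁ x y) : signature G₁ = signature G₂ := by
  have h : Equivalent G₁.toQuadraticMap G₂.toQuadraticMap := ⟨⟨e, fun x => he x x⟩⟩
  rw [signature, signature, h.sigPos_eq, h.sigNeg_eq]

theorem signature_eq_sum_sign [FiniteDimensional ℝ E] {G : LinearMap.BilinForm ℝ E}
    {ι : Type*} [Fintype ι] {w : ι → ℝ}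
    (h : Equivalent G.toQuadraticMap (weightedSumSquares ℝ w)) :
    signature G = ∑ i, (SignType.sign (w i) : ℤ) := by
  classical
  rw [signature, QuadraticForm.sigPos_of_equiv_weightedSumSquares h,
    QuadraticForm.sigNeg_of_equiv_weightedSumSquares h, Set.ncard_eq_toFinset_card',
    Set.ncard_eq_toFinset_card', Set.toFinset_ofPred, Set.toFinset_ofPred, Finset.card_filter,
    Finset.card_filter]
  push_cast
  rw [← Finset.sum_sub_distrib]
  refine Finset.sum_congr rfl fun i _ => ?_
  rcases lt_trichotomy (w i) 0 with h | h | h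
  · simp [h, h.not_gt]
  · simp [h]
  · simp [h, h.not_gt]

theorem exists_equivalent_weightedSumSquares [FiniteDimensional ℝ E] {G : LinearMap.BilinForm ℝ E}
    (hs : G.IsSymm) (hn : G.Nondegenerate) :
    ∃ w : Fin (Module.finrank ℝ E) → ℝ, (∀ i, w i = -1 ∨ w i = 1) ∧
      Equivalent G.toQuadraticMap (weightedSumSquares ℝ w) := by
  refine QuadraticForm.equivalent_one_neg_one_weighted_sum_squared _ ?_
  have h := associated_left_inverse (S := ℝ) hs.eq
  exact h.symm ▸ hn.1

/-- The numbers of +1 and -1 have known sum and difference; doubling avoids division. -/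
theorem two_mul_card_eq_of_sign {ι : Type*} [Fintype ι] {w : ι → ℝ} (hw : ∀ i, w i = -1 ∨ w i = 1) :
    2 * (Nat.card {i // w i = 1} : ℤ) = Nat.card ι + ∑ i, (SignType.sign (w i) : ℤ) ∧
      2 * (Nat.card {i // w i = -1} : ℤ) = Nat.card ι - ∑ i, (SignType.sign (w i) : ℤ) := by
  classical
  rw [Nat.card_eq_fintype_card, Nat.card_eq_fintype_card, Nat.card_eq_fintype_card,
    Fintype.card_subtype, Fintype.card_subtype, Finset.card_filter, Finset.card_filter,
    ← Finset.card_univ, Finset.card_eq_sum_ones]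
  push_cast
  rw [Finset.mul_sum, Finset.mul_sum, ← Finset.sum_add_distrib, ← Finset.sum_sub_distrib]
  constructor <;> refine Finset.sum_congr rfl fun i _ => ?_ <;> rcases hw i with h | h <;>
    norm_num [h]

/-- Equal length and equal sum of signs force equally many entries of each sign, so the fibres of
the two families can be matched one by one. -/
theorem exists_equiv_of_sum_sign_eq {ι₁ ι₂ : Type*} [Fintype ι₁] [Fintype ι₂] {w₁ : ι₁ → ℝ}
    {w₂ : ι₂ → ℝ} (h₁ : ∀ i, w₁ i = -1 ∨ w₁ i = 1) (h₂ : ∀ i, w₂ i = -1 ∨ w₂ i = 1)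
    (hcard : Fintype.card ι₁ = Fintype.card ι₂)
    (hsum : ∑ i, (SignType.sign (w₁ i) : ℤ) = ∑ i, (SignType.sign (w₂ i) : ℤ)) :
    ∃ e : ι₁ ≃ ι₂, ∀ i, w₂ (e i) = w₁ i := by
  have hfib : ∀ c : ℝ, Nonempty ({i // w₁ i = c} ≃ {i // w₂ i = c}) := by
    intro c
    have k₁ := two_mul_card_eq_of_sign h₁
    have k₂ := two_mul_card_eq_of_sign h₂
    rw [Nat.card_eq_fintype_card (α := ι₁), hcard, ← Nat.card_eq_fintype_card] at k₁
    by_cases hc : c = 1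
    · subst hc; exact Finite.card_eq.1 (by omega)
    by_cases hc' : c = -1
    · subst hc'; exact Finite.card_eq.1 (by omega)
    have e₁ : IsEmpty {i // w₁ i = c} := ⟨fun x => by rcases h₁ x.1 with h | h <;> grind⟩
    have e₂ : IsEmpty {i // w₂ i = c} := ⟨fun x => by rcases h₂ x.1 with h | h <;> grind⟩
    exact ⟨Equiv.equivOfIsEmpty _ _⟩
  exact ⟨Equiv.ofFiberEquiv fun c => (hfib c).some, fun i => Equiv.ofFiberEquiv_map _ i⟩

/-- Sylvester's classification of nondegenerate symmetric forms by dimension and signature. -/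
theorem exists_isometry_of_signature_eq [FiniteDimensional ℝ E₁] [FiniteDimensional ℝ E₂]
    {G₁ : LinearMap.BilinForm ℝ E₁} {G₂ : LinearMap.BilinForm ℝ E₂} (hs₁ : G₁.IsSymm)
    (hn₁ : G₁.Nondegenerate) (hs₂ : G₂.IsSymm) (hn₂ : G₂.Nondegenerate)
    (hdim : Module.finrank ℝ E₁ = Module.finrank ℝ E₂) (hsig : signature G₁ = signature G₂) :
    ∃ e : E₁ ≃ₗ[ℝ] E₂, ∀ x y, G₂ (e x) (e y) = G₁ x y := by
  obtain ⟨w₁, hw₁, he₁⟩ := exists_equivalent_weightedSumSquares hs₁ hn₁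
  obtain ⟨w₂, hw₂, he₂⟩ := exists_equivalent_weightedSumSquares hs₂ hn₂
  rw [signature_eq_sum_sign he₁, signature_eq_sum_sign he₂] at hsig
  obtain ⟨σ, hσ⟩ := exists_equiv_of_sum_sign_eq hw₁ hw₂ (by simpa using hdim) hsig
  have he : Equivalent (weightedSumSquares ℝ w₁) (weightedSumSquares ℝ w₂) :=
    ⟨⟨LinearEquiv.funCongrLeft ℝ ℝ σ.symm, fun x => by
      simp only [weightedSumSquares_apply]
      refine (Fintype.sum_equiv σ _ _ fun i => ?_).symm
      simp [LinearMap.funLeft_apply, hσ]⟩⟩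
  obtain ⟨f⟩ := (he₁.trans he).trans he₂.symm
  refine ⟨f.toLinearEquiv, fun x y => ?_⟩
  -- The equivalence preserves the quadratic forms; polarization with x + y carries this over to the
  -- bilinear forms.
  have hf : ∀ z, G₂ (f.toLinearEquiv z) (f.toLinearEquiv z) = G₁ z z := fun z => f.map_app z
  have h := hf (x + y)
  simp only [map_add, LinearMap.add_apply, hf, hs₁.eq y x,
    hs₂.eq (f.toLinearEquiv y) (f.toLinearEquiv x)] at h
  linarith

end Signature

/-! ### Frames with Gram matrix η ⊕ c⁻¹η and the ambient signature. -/

section Frame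

variable {η : Matrix (Fin N) (Fin N) ℝ} {c : ℝ} {G : LinearMap.BilinForm ℝ (Ambient N)}

theorem toBilin'_isSymm (hη : IsMetricMatrix η) : (Matrix.toBilin' η).IsSymm := by
  refine ⟨fun x y => ?_⟩
  rw [Matrix.toBilin'_apply, Matrix.toBilin'_apply, Finset.sum_comm]
  refine Finset.sum_congr rfl fun i _ => Finset.sum_congr rfl fun j _ => ?_
  rw [hη.1.apply i j]
  ring

/-- The form `η ⊕ c⁻¹ η`. -/
noncomputable def blockForm (η : Matrix (Fin N) (Fin N) ℝ) (c : ℝ) :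
    LinearMap.BilinForm ℝ (Coord N × Coord N) :=
  (Matrix.toBilin' η).compl₁₂ (LinearMap.fst ℝ _ _) (LinearMap.fst ℝ _ _) +
    c⁻¹ • (Matrix.toBilin' η).compl₁₂ (LinearMap.snd ℝ _ _) (LinearMap.snd ℝ _ _)

theorem blockForm_apply (z w : Coord N × Coord N) : blockForm η c z w =
    Matrix.toBilin' η z.1 w.1 + c⁻¹ * Matrix.toBilin' η z.2 w.2 := rfl

theorem blockForm_isSymm (hη : IsMetricMatrix η) : (blockForm η c).IsSymm :=
  ⟨fun z w => by
    rw [blockForm_apply, blockForm_apply, (toBilin'_isSymm hη).eq, (toBilin'_isSymm hη).eq w.2]⟩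

theorem blockForm_nondegenerate (hη : IsMetricMatrix η) (hc : c ≠ 0) :
    (blockForm η c).Nondegenerate := by
  have hn := (LinearMap.BilinForm.nondegenerate_toBilin'_of_det_ne_zero' η hη.2).1
  have h : (blockForm η c).SeparatingLeft := by
    intro z hz
    refine Prod.ext (hn _ fun y => ?_) (hn _ fun y => ?_)
    · simpa [blockForm_apply] using hz (y, 0)
    · simpa [blockForm_apply, hc] using hz (0, y)
  exact ⟨h, fun z hz => h z fun w => by rw [(blockForm_isSymm hη).eq, hz w]⟩

/-- One diagonalization of η with weights w, used on both blocks, gives the weights w and c⁻¹w.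
Their signs double for c > 0 and cancel for c < 0. -/
theorem signature_blockForm (hη : IsMetricMatrix η) (hc : c ≠ 0) :
    signature (blockForm η c) = if 0 < c then 2 * signature (Matrix.toBilin' η) else 0 := by
  obtain ⟨w, -, ⟨f⟩⟩ := exists_equivalent_weightedSumSquares (toBilin'_isSymm hη)
    (LinearMap.BilinForm.nondegenerate_toBilin'_of_det_ne_zero' η hη.2)
  have hf : ∀ x, ∑ i, w i • (f.toLinearEquiv x i * f.toLinearEquiv x i) =
      Matrix.toBilin' η x x := fun x => by
    rw [← QuadraticMap.weightedSumSquares_apply]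
    exact f.map_app x
  have hblock : QuadraticMap.Equivalent (blockForm η c).toQuadraticMap
      (QuadraticMap.weightedSumSquares ℝ (Sum.elim w fun i => c⁻¹ * w i)) := by
    refine ⟨⟨(f.toLinearEquiv.prodCongr f.toLinearEquiv).trans
      (LinearEquiv.sumArrowLequivProdArrow _ _ ℝ ℝ).symm, fun z => ?_⟩⟩
    change QuadraticMap.weightedSumSquares ℝ _ _ = blockForm η c z z
    rw [blockForm_apply, ← hf, ← hf, QuadraticMap.weightedSumSquares_apply, Fintype.sum_sum_type,
      Finset.mul_sum]
    simp [mul_assoc]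
  rw [signature_eq_sum_sign hblock, signature_eq_sum_sign ⟨f⟩, Fintype.sum_sum_type]
  split_ifs with h
  · simp [sign_mul, h, two_mul]
  · have : c < 0 := lt_of_le_of_ne (not_lt.1 h) hc
    simp [sign_mul, this]

/-- The vectors `p_i` and `q_i` have the Gram matrix `η ⊕ c⁻¹ η`. -/
structure IsGramFrame (G : LinearMap.BilinForm ℝ (Ambient N)) (η : Matrix (Fin N) (Fin N) ℝ)
    (c : ℝ) (p q : Fin N → Ambient N) : Prop where
  tangent : ∀ i j, G (p i) (p j) = η i j
  normal : ∀ i j, G (q i) (p j) = 0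
  gram : ∀ i j, G (q i) (q j) = c⁻¹ * η i j

/-- The linear combinations `∑ xⁱ p_i + ∑ yⁱ q_i`. -/
def frameMap (p q : Fin N → Ambient N) : Coord N × Coord N →ₗ[ℝ] Ambient N :=
  (Fintype.linearCombination ℝ p).coprod (Fintype.linearCombination ℝ q)

theorem frameMap_apply (p q : Fin N → Ambient N) (z : Coord N × Coord N) :
    frameMap p q z = ∑ i, z.1 i • p i + ∑ i, z.2 i • q i := by
  simp [frameMap, Fintype.linearCombination_apply]

theorem frameMap_fst (p q : Fin N → Ambient N) (i : Fin N) :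
    frameMap p q (Pi.single i 1, 0) = p i := by
  simp [frameMap]

theorem frameMap_snd (p q : Fin N → Ambient N) (i : Fin N) :
    frameMap p q (0, Pi.single i 1) = q i := by
  simp [frameMap]

variable {p q : Fin N → Ambient N}

theorem IsGramFrame.map_frameMap (hG : G.IsSymm) (h : IsGramFrame G η c p q)
    (z w : Coord N × Coord N) : G (frameMap p q z) (frameMap p q w) = blockForm η c z w := by
  have h' : ∀ i j, G (p i) (q j) = 0 := fun i j => by rw [hG.eq, h.normal]
  rw [blockForm_apply, Matrix.toBilin'_apply, Matrix.toBilin'_apply, frameMap_apply,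
    frameMap_apply]
  simp only [map_add, map_sum, map_smul, LinearMap.add_apply, LinearMap.sum_apply,
    LinearMap.smul_apply, h.tangent, h.normal, h.gram, h', smul_eq_mul, mul_zero,
    Finset.sum_const_zero, add_zero, zero_add, Finset.mul_sum]
  congr 1
  · rw [Finset.sum_comm]
    exact Finset.sum_congr rfl fun i _ => Finset.sum_congr rfl fun j _ => by ring
  · rw [Finset.sum_comm]
    exact Finset.sum_congr rfl fun i _ => Finset.sum_congr rfl fun j _ => by ring

/-- `frameMap` preserves scalar products, so its kernel lies in the radical of the block form, which
is zero. By dimension the frame is then a basis of the ambient space. -/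
theorem IsGramFrame.injective_frameMap (hη : IsMetricMatrix η) (hc : c ≠ 0) (hG : G.IsSymm)
    (h : IsGramFrame G η c p q) : Function.Injective (frameMap p q) := by
  rw [← LinearMap.ker_eq_bot, LinearMap.ker_eq_bot']
  intro z hz
  refine (blockForm_nondegenerate hη hc).1 z fun w => ?_
  rw [← h.map_frameMap hG, hz, map_zero, LinearMap.zero_apply]

theorem finrank_prod_coord (N : ℕ) :
    Module.finrank ℝ (Coord N × Coord N) = Module.finrank ℝ (Ambient N) := by
  simp [two_mul]

/-- A frame with a nondegenerate Gram matrix as a linear equivalence. -/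
noncomputable def IsGramFrame.equiv (hη : IsMetricMatrix η) (hc : c ≠ 0) (hG : G.IsSymm)
    (h : IsGramFrame G η c p q) : (Coord N × Coord N) ≃ₗ[ℝ] Ambient N :=
  LinearMap.linearEquivOfInjective _ (h.injective_frameMap hη hc hG) (finrank_prod_coord N)

theorem IsGramFrame.equiv_apply (hη : IsMetricMatrix η) (hc : c ≠ 0) (hG : G.IsSymm)
    (h : IsGramFrame G η c p q) (z : Coord N × Coord N) :
    h.equiv hη hc hG z = frameMap p q z := rfl

theorem IsGramFrame.signature_eq (hη : IsMetricMatrix η) (hc : c ≠ 0) (hG : G.IsSymm)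
    (h : IsGramFrame G η c p q) :
    signature G = if 0 < c then 2 * signature (Matrix.toBilin' η) else 0 := by
  rw [← signature_blockForm hη hc]
  exact (signature_eq_of_isometry (h.equiv hη hc hG) (h.map_frameMap hG)).symm

theorem IsGramFrame.linearIndependent (hη : IsMetricMatrix η) (hc : c ≠ 0) (hG : G.IsSymm)
    (h : IsGramFrame G η c p q) : LinearIndependent ℝ p := by
  rw [Fintype.linearIndependent_iffₛ]
  intro x y hxy
  have : ((x, 0) : Coord N × Coord N) = (y, 0) := h.injective_frameMap hη hc hG (by
    simpa [frameMap_apply] using hxy)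
  exact fun i => congrFun (Prod.ext_iff.1 this).1 i

/-- The frame spans and `G` is nondegenerate, so vectors may be compared through their products with
the frame. The Gauss and Weingarten formulas are proved this way. -/
theorem IsGramFrame.ext (hη : IsMetricMatrix η) (hc : c ≠ 0) (hG : IsPseudoEuclidean G)
    (h : IsGramFrame G η c p q) {x y : Ambient N} (hp : ∀ i, G x (p i) = G y (p i))
    (hq : ∀ i, G x (q i) = G y (q i)) : x = y := by
  rw [← sub_eq_zero]
  refine hG.2.1 _ fun z => ?_
  obtain ⟨w, rfl⟩ := (h.equiv hη hc hG.1).surjective z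
  rw [IsGramFrame.equiv_apply, frameMap_apply]
  simp [hp, hq]

/-- Sylvester's law supplies an isometry from η ⊕ c⁻¹η onto the ambient space; the frame is the
image of the standard basis. -/
theorem IsGramFrame.exists_of_signature_eq (hη : IsMetricMatrix η) (hc : c ≠ 0)
    (hG : IsPseudoEuclidean G)
    (hsig : signature G = if 0 < c then 2 * signature (Matrix.toBilin' η) else 0) :
    ∃ p q, IsGramFrame G η c p q := by
  rw [← signature_blockForm hη hc] at hsig
  obtain ⟨e, he⟩ := exists_isometry_of_signature_eq (blockForm_isSymm hη)
    (blockForm_nondegenerate hη hc) hG.1 hG.2 (finrank_prod_coord N) hsig.symm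
  refine ⟨fun i => e (Pi.single i 1, 0), fun i => e (0, Pi.single i 1),
    ⟨fun i j => ?_, fun i j => ?_, fun i j => ?_⟩⟩ <;>
  simp [he, blockForm_apply]

theorem exists_isPseudoEuclidean_signature (hη : IsMetricMatrix η) (hc : c ≠ 0) :
    ∃ G : LinearMap.BilinForm ℝ (Ambient N), IsPseudoEuclidean G ∧
      signature G = if 0 < c then 2 * signature (Matrix.toBilin' η) else 0 := by
  let e := LinearEquiv.ofFinrankEq _ _ (finrank_prod_coord N)
  refine ⟨LinearMap.BilinForm.congr e (blockForm η c), ⟨⟨fun x y => ?_⟩,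
    (blockForm_nondegenerate hη hc).congr e⟩, ?_⟩
  · simp [LinearMap.BilinForm.congr_apply, (blockForm_isSymm hη).eq]
  · rw [← signature_blockForm hη hc]
    exact (signature_eq_of_isometry e fun x y => by simp [LinearMap.BilinForm.congr_apply]).symm

end Frame

end PotentialSubmanifold

/-! ### The Gauss and Weingarten formulas: from submanifolds to (L). -/

namespace PotentialSubmanifold

variable {N : ℕ} {η : Matrix (Fin N) (Fin N) ℝ} {c : ℝ} {Φ : Coord N → ℝ} {U V : Set (Coord N)}
  {G : LinearMap.BilinForm ℝ (Ambient N)} {r n : Coord N → Ambient N}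
  {b : Fin N → Coord N → Ambient N}

section Equations

theorem IsPotentialSubmanifold.isGramFrame (h : IsPotentialSubmanifold G η c Φ V r b)
    {u : Coord N} (hu : u ∈ V) : IsGramFrame G η c (fun i => pd i r u) fun i => b i u :=
  ⟨fun i j => congrFun (congrFun (h.first_form u hu) i) j, h.normal u hu, h.gram u hu⟩

/-- This is the vanishing of the Christoffel symbols: (r_ij, r_k) is symmetric in i, j and, the
metric being constant, skew in j, k. Such an array is zero. -/
theorem IsPotentialSubmanifold.tangential_second_derivative
    (hV : IsOpen V) (hG : G.IsSymm) (h : IsPotentialSubmanifold G η c Φ V r b)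
    {u : Coord N} (hu : u ∈ V) (i j k : Fin N) : G (pd i (pd j r) u) (pd k r u) = 0 := by
  have hd := fun i => differentiableAt_of_contDiffOn hV (contDiffOn_pd hV h.smooth_r i) hu
  have hskew : ∀ i j k, G (pd i (pd j r) u) (pd k r u) = -G (pd i (pd k r) u) (pd j r u) := by
    intro i j k
    have h1 := pd_congr hV (fun x hx => (h.isGramFrame hx).tangent j k) hu i
    rw [pd_bilin G (hd j) (hd k), pd_const, hG.eq (pd j r u)] at h1
    linarith
  have hsymm : ∀ i j k, G (pd i (pd j r) u) (pd k r u) = G (pd j (pd i r) u) (pd k r u) :=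
    fun i j k => by rw [pd_comm hV h.smooth_r hu]
  linarith [hskew i j k, hsymm i k j, hskew k i j, hsymm k j i, hskew j k i, hsymm j i k]

theorem IsPotentialSubmanifold.eq_r (hη : IsMetricMatrix η) (hc : c ≠ 0)
    (hG : IsPseudoEuclidean G) (hU : IsOpen U) (hΦ : ContDiffOn ℝ ∞ Φ U) (hV : IsOpen V)
    (hVU : V ⊆ U) (h : IsPotentialSubmanifold G η c Φ V r b) {u : Coord N} (hu : u ∈ V)
    (i j : Fin N) : pd i (pd j r) u = c • ∑ l, coeff η Φ l i j u • b l u := by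
  have hf := h.isGramFrame hu
  refine hf.ext hη hc hG (fun k => ?_) fun k => ?_
  · rw [h.tangential_second_derivative hV hG.1 hu]
    simp [hf.normal]
  · have h1 : G (b k u) (pd i (pd j r) u) = third Φ k i j u := h.second_form u hu k i j
    have h2 : ∑ l, coeff η Φ l i j u * (c⁻¹ * η l k) = c⁻¹ * third Φ i j k u := by
      rw [← sum_coeff_mul_metric hη, Finset.mul_sum]
      exact Finset.sum_congr rfl fun l _ => by ring
    rw [hG.1.eq, h1]
    simp only [map_smul, map_sum, LinearMap.smul_apply, LinearMap.sum_apply, hf.gram, smul_eq_mul,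
      h2]
    rw [mul_inv_cancel_left₀ hc, third_comm₁₂ hU hΦ (hVU hu), third_comm₂₃ hU hΦ (hVU hu)]

/-- Differentiating (b_j, r_k) = 0 gives the tangential part as minus the second form; zero torsion
removes the normal part. -/
theorem IsPotentialSubmanifold.eq_b (hη : IsMetricMatrix η) (hc : c ≠ 0)
    (hG : IsPseudoEuclidean G) (hU : IsOpen U) (hΦ : ContDiffOn ℝ ∞ Φ U) (hV : IsOpen V)
    (hVU : V ⊆ U) (h : IsPotentialSubmanifold G η c Φ V r b) {u : Coord N} (hu : u ∈ V)
    (i j : Fin N) : pd i (b j) u = -∑ l, coeff η Φ l i j u • pd l r u := by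
  have hf := h.isGramFrame hu
  refine hf.ext hη hc hG (fun k => ?_) fun k => ?_
  · have h1 := pd_congr hV (fun x hx => h.normal x hx j k) hu i
    rw [pd_bilin G (differentiableAt_of_contDiffOn hV (h.smooth_b j) hu)
      (differentiableAt_of_contDiffOn hV (contDiffOn_pd hV h.smooth_r k) hu), pd_const] at h1
    have h2 : G (b j u) (pd i (pd k r) u) = third Φ j i k u := h.second_form u hu j i k
    simp only [map_neg, map_sum, map_smul, LinearMap.neg_apply, LinearMap.sum_apply,
      LinearMap.smul_apply, hf.tangent, smul_eq_mul, sum_coeff_mul_metric hη]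
    rw [third_comm₁₂ hU hΦ (hVU hu)]
    linarith
  · have h1 : G (pd i (b j) u) (b k u) = 0 := h.torsionless u hu j k i
    rw [h1]
    simp [hG.1.eq (pd _ r u), hf.normal]

/-- By the Weingarten formula ∂_i b_j is symmetric in i, j, so the normal fields are locally the
partial derivatives of one vector function n. -/
theorem IsPotentialSubmanifold.exists_solvesSystem (hη : IsMetricMatrix η) (hc : c ≠ 0)
    (hG : IsPseudoEuclidean G) (hU : IsOpen U) (hΦ : ContDiffOn ℝ ∞ Φ U) (hV : IsOpen V)
    (hVU : V ⊆ U) (h : IsPotentialSubmanifold G η c Φ V r b) {u₀ : Coord N} (hu₀ : u₀ ∈ V) :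
    ∃ W : Set (Coord N), IsOpen W ∧ u₀ ∈ W ∧ W ⊆ V ∧ ∃ n : Coord N → Ambient N,
      (∀ u ∈ W, ∀ α, pd α n u = b α u) ∧ SolvesSystem η c Φ W r n := by
  obtain ⟨ρ, hρ, hball, n, hns, hn⟩ := exists_primitive_of_closed hV h.smooth_b
    (fun u hu i j => by
      rw [h.eq_b hη hc hG hU hΦ hV hVU hu, h.eq_b hη hc hG hU hΦ hV hVU hu]
      simp only [coeff_comm hU hΦ (hVU hu) _ i j]) hu₀
  refine ⟨_, Metric.isOpen_ball, Metric.mem_ball_self hρ, hball, n, hn,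
    h.smooth_r.mono hball, hns, fun u hu i j => ?_, fun u hu i j => ?_⟩
  · rw [h.eq_r hη hc hG hU hΦ hV hVU (hball hu), sum_sum_smul_eq_sum_coeff_smul]
    simp only [hn u hu]
  · rw [pd_congr Metric.isOpen_ball (fun x hx => hn x hx j) hu,
      h.eq_b hη hc hG hU hΦ hV hVU (hball hu), sum_sum_smul_eq_sum_coeff_smul]

end Equations

/-! ### Propagation of the scalar products: from (L) to submanifolds. -/

section Gram

/-- The linear system satisfied by the scalar products `(r_i, r_j)`, `(n_i, r_j)`, `(n_i, n_j)`. -/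
def gramOperator (c : ℝ) (T : Fin N → Fin N → ℝ) :
    (Fin N → Fin N → ℝ) × (Fin N → Fin N → ℝ) × (Fin N → Fin N → ℝ) →ₗ[ℝ]
      (Fin N → Fin N → ℝ) × (Fin N → Fin N → ℝ) × (Fin N → Fin N → ℝ) where
  toFun y := (fun i j => ∑ l, (c * T l i * y.2.1 l j + c * T l j * y.2.1 l i),
    fun i j => ∑ l, (-(T l i * y.1 l j) + c * T l j * y.2.2 i l),
    fun i j => ∑ l, (-(T l i * y.2.1 j l) - T l j * y.2.1 i l))
  map_add' y z := by
    ext i j <;> simp only [Prod.fst_add, Prod.snd_add, Pi.add_apply, ← Finset.sum_add_distrib] <;>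
      exact Finset.sum_congr rfl fun l _ => by ring
  map_smul' a y := by
    ext i j <;> simp only [Prod.smul_fst, Prod.smul_snd, Pi.smul_apply, smul_eq_mul,
      RingHom.id_apply, Finset.mul_sum] <;> exact Finset.sum_congr rfl fun l _ => by ring

theorem contDiffOn_gramOperator (hU : IsOpen U) (hΦ : ContDiffOn ℝ ∞ Φ U) (k : Fin N)
    (y : (Fin N → Fin N → ℝ) × (Fin N → Fin N → ℝ) × (Fin N → Fin N → ℝ)) :
    ContDiffOn ℝ ∞ (fun u => gramOperator c (fun l i => coeff η Φ l k i u) y) U := by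
  have hs := fun l i => contDiffOn_coeff (η := η) hU hΦ l k i
  refine ContDiffOn.prodMk ?_ (ContDiffOn.prodMk ?_ ?_) <;>
    refine contDiffOn_pi.2 fun i => contDiffOn_pi.2 fun j => ContDiffOn.sum fun l _ => ?_
  · exact ((contDiffOn_const.mul (hs l i)).mul contDiffOn_const).add
      ((contDiffOn_const.mul (hs l j)).mul contDiffOn_const)
  · exact (((hs l i)).mul contDiffOn_const).neg.add
      ((contDiffOn_const.mul (hs l j)).mul contDiffOn_const)
  · exact (((hs l i)).mul contDiffOn_const).neg.sub ((hs l j).mul contDiffOn_const)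

/-- The scalar products of the derivatives of r and n satisfy the system of `gramOperator`, and so
does the constant triple (η, 0, c⁻¹η). They agree at one point, hence on connected `V`. -/
theorem SolvesSystem.isGramFrame (hη : IsMetricMatrix η) (hc : c ≠ 0) (hG : G.IsSymm)
    (hU : IsOpen U) (hΦ : ContDiffOn ℝ ∞ Φ U) (hV : IsOpen V) (hVc : IsPreconnected V)
    (hVU : V ⊆ U) (h : SolvesSystem η c Φ V r n) {u₀ : Coord N} (hu₀ : u₀ ∈ V)
    (h0 : IsGramFrame G η c (fun i => pd i r u₀) fun i => pd i n u₀) {u : Coord N} (hu : u ∈ V) :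
    IsGramFrame G η c (fun i => pd i r u) fun i => pd i n u := by
  have hrs := fun i => contDiffOn_pd hV h.smooth_r i
  have hns := fun i => contDiffOn_pd hV h.smooth_n i
  have key := eqOn_of_linear_system hV hVc
    (Y := fun u => (fun i j => G (pd i r u) (pd j r u), fun i j => G (pd i n u) (pd j r u),
      fun i j => G (pd i n u) (pd j n u)))
    (Z := fun _ => (fun i j => η i j, fun _ _ => 0, fun i j => c⁻¹ * η i j))
    (fun k y => (contDiffOn_gramOperator (η := η) (c := c) hU hΦ k y).mono hVU)
    (ContDiffOn.prodMk
      (contDiffOn_pi.2 fun i => contDiffOn_pi.2 fun j => contDiffOn_bilin G (hrs i) (hrs j))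
      (ContDiffOn.prodMk
        (contDiffOn_pi.2 fun i => contDiffOn_pi.2 fun j => contDiffOn_bilin G (hns i) (hrs j))
        (contDiffOn_pi.2 fun i => contDiffOn_pi.2 fun j => contDiffOn_bilin G (hns i) (hns j))))
    contDiffOn_const (fun u hu k => ?_) (fun u hu k => ?_) hu₀ ?_ u hu
  · simp only [Prod.mk.injEq] at key
    exact ⟨fun i j => congrFun (congrFun key.1 i) j, fun i j => congrFun (congrFun key.2.1 i) j,
      fun i j => congrFun (congrFun key.2.2 i) j⟩
  · have hd : ∀ {f g : Fin N → Coord N → Ambient N}, (∀ i, ContDiffOn ℝ ∞ (f i) V) →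
        (∀ i, ContDiffOn ℝ ∞ (g i) V) → ∀ i j, DifferentiableAt ℝ (fun u => G (f i u) (g j u)) u :=
      fun hf hg i j => differentiableAt_of_contDiffOn hV (contDiffOn_bilin G (hf i) (hg j)) hu
    have hd' : ∀ {f g : Fin N → Coord N → Ambient N}, (∀ i, ContDiffOn ℝ ∞ (f i) V) →
        (∀ i, ContDiffOn ℝ ∞ (g i) V) →
        DifferentiableAt ℝ (fun u i j => G (f i u) (g j u)) u :=
      fun hf hg => differentiableAt_pi.2 fun i => differentiableAt_pi.2 fun j => hd hf hg i j
    have hpd : ∀ {f g : Fin N → Coord N → Ambient N}, (∀ i, ContDiffOn ℝ ∞ (f i) V) →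
        (∀ i, ContDiffOn ℝ ∞ (g i) V) → pd k (fun u i j => G (f i u) (g j u)) u =
        fun i j => G (pd k (f i) u) (g j u) + G (f i u) (pd k (g j) u) := fun hf hg => by
      rw [pd_pi fun i => differentiableAt_pi.2 fun j => hd hf hg i j]
      ext i j
      rw [pd_pi fun j => hd hf hg i j]
      exact pd_bilin G (differentiableAt_of_contDiffOn hV (hf i) hu)
        (differentiableAt_of_contDiffOn hV (hg j) hu) k
    rw [pd_prodMk (hd' hrs hrs) ((hd' hns hrs).prodMk (hd' hns hns)),
      pd_prodMk (hd' hns hrs) (hd' hns hns), hpd hrs hrs, hpd hns hrs, hpd hns hns]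
    simp only [h.eq_r_coeff hu, h.eq_n_coeff hu, map_smul, map_sum, map_neg, LinearMap.smul_apply,
      LinearMap.sum_apply, LinearMap.neg_apply, smul_eq_mul, Finset.mul_sum, gramOperator,
      LinearMap.coe_mk, AddHom.coe_mk, Finset.sum_add_distrib,
      Finset.sum_neg_distrib, mul_assoc, sub_eq_add_neg, hG.eq (pd _ r u) (pd _ n u)]
  -- For the constant triple only the middle block needs an argument: it is -Φ_kij + c·c⁻¹Φ_kij. The
  -- normalization c⁻¹η of the normal frame is what makes this vanish.
  · rw [pd_const]
    have e1 : ∀ i j : Fin N, ∑ l, coeff η Φ l k i u * η l j = third Φ k i j u :=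
      fun i j => sum_coeff_mul_metric hη k i j u
    have e2 : ∀ i j : Fin N, ∑ l, c * coeff η Φ l k j u * (c⁻¹ * η i l) = third Φ k i j u := by
      intro i j
      rw [third_comm₂₃ hU hΦ (hVU hu), ← sum_coeff_mul_metric hη]
      refine Finset.sum_congr rfl fun l _ => ?_
      rw [hη.1.apply i l]
      field_simp
    refine Prod.ext ?_ (Prod.ext ?_ ?_) <;> ext i j <;>
      simp [gramOperator, Finset.sum_add_distrib, e1, e2]
  · simp [h0.tangent, h0.normal, h0.gram]

theorem SolvesSystem.isPotentialSubmanifold (hη : IsMetricMatrix η) (hc : c ≠ 0)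
    (hG : G.IsSymm) (hU : IsOpen U) (hΦ : ContDiffOn ℝ ∞ Φ U) (hV : IsOpen V)
    (hVc : IsPreconnected V) (hVU : V ⊆ U) (h : SolvesSystem η c Φ V r n) {u₀ : Coord N}
    (hu₀ : u₀ ∈ V) (h0 : IsGramFrame G η c (fun i => pd i r u₀) fun i => pd i n u₀) :
    IsPotentialSubmanifold G η c Φ V r fun α => pd α n := by
  have hf := fun u hu => h.isGramFrame hη hc hG hU hΦ hV hVc hVU hu₀ h0 (u := u) hu
  refine ⟨h.smooth_r, contDiffOn_pd hV h.smooth_n,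
    fun u hu => (hf u hu).linearIndependent hη hc hG,
    fun u hu => Matrix.ext fun i j => (hf u hu).tangent i j, fun u hu => (hf u hu).normal,
    fun u hu => (hf u hu).gram, fun u hu α β i => ?_, fun u hu α i j => ?_⟩
  · rw [torsion, h.eq_n_coeff hu]
    simp [hG.eq (pd _ r u), (hf u hu).normal]
  · have h2 : ∑ l, coeff η Φ l i j u * (c⁻¹ * η l α) = c⁻¹ * third Φ i j α u := by
      rw [← sum_coeff_mul_metric hη, Finset.mul_sum]
      exact Finset.sum_congr rfl fun l _ => by ring
    rw [secondForm, h.eq_r_coeff hu, hG.eq]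
    simp only [map_smul, map_sum, LinearMap.smul_apply, LinearMap.sum_apply, (hf u hu).gram,
      smul_eq_mul, h2]
    rw [mul_inv_cancel_left₀ hc, third_comm₁₂ hU hΦ (hVU hu) α, third_comm₂₃ hU hΦ (hVU hu) i α]

end Gram

/-! ### Uniqueness up to motions. -/

section Uniqueness

/-- The frames at one point have the same Gram matrix, so the linear map `A` carrying one to the
other is an isometry. The moved submanifold and the second one then have frames solving the same
linear system with the same value at that point. The frames coincide, and the maps r differ by a
constant, the translation part. -/
theorem IsPotentialSubmanifold.exists_motion (hη : IsMetricMatrix η) (hc : c ≠ 0)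
    (hG : IsPseudoEuclidean G) (hU : IsOpen U) (hΦ : ContDiffOn ℝ ∞ Φ U) (hV : IsOpen V)
    (hVc : IsPreconnected V) (hVU : V ⊆ U) {r' : Coord N → Ambient N}
    {b' : Fin N → Coord N → Ambient N} (h : IsPotentialSubmanifold G η c Φ V r b)
    (h' : IsPotentialSubmanifold G η c Φ V r' b') :
    ∃ (A : Ambient N ≃ₗ[ℝ] Ambient N) (v : Ambient N), (∀ x y, G (A x) (A y) = G x y) ∧
      ∀ u ∈ V, r' u = A (r u) + v ∧ ∀ α, b' α u = A (b α u) := by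
  rcases V.eq_empty_or_nonempty with rfl | ⟨u₀, hu₀⟩
  · exact ⟨LinearEquiv.refl ℝ _, 0, fun x y => rfl, fun u hu => hu.elim⟩
  have hf := h.isGramFrame hu₀
  have hf' := h'.isGramFrame hu₀
  let A := (hf.equiv hη hc hG.1).symm.trans (hf'.equiv hη hc hG.1)
  have hAmap : ∀ z, A (frameMap (fun i => pd i r u₀) (fun i => b i u₀) z) =
      frameMap (fun i => pd i r' u₀) (fun i => b' i u₀) z := fun z => by
    rw [← hf.equiv_apply hη hc hG.1, ← hf'.equiv_apply hη hc hG.1]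
    simp [A]
  have hAr : ∀ i, A (pd i r u₀) = pd i r' u₀ := fun i => by
    simpa only [frameMap_fst] using hAmap (Pi.single i 1, 0)
  have hAb : ∀ i, A (b i u₀) = b' i u₀ := fun i => by
    simpa only [frameMap_snd] using hAmap (0, Pi.single i 1)
  have hAG : ∀ x y, G (A x) (A y) = G x y := by
    intro x y
    obtain ⟨z, rfl⟩ := (hf.equiv hη hc hG.1).surjective x
    obtain ⟨w, rfl⟩ := (hf.equiv hη hc hG.1).surjective y
    rw [hf.equiv_apply, hf.equiv_apply, hAmap, hAmap, hf.map_frameMap hG.1, hf'.map_frameMap hG.1]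
  let L : Ambient N →L[ℝ] Ambient N :=
    LinearMap.toContinuousLinearMap (A : Ambient N →ₗ[ℝ] Ambient N)
  have hL : ∀ x, L x = A x := fun x => rfl
  -- The Gauss and Weingarten formulas close up into the system of `frameOperator`, whose
  -- coefficients depend only on η, c and Φ.
  have hframe : ∀ {s : Coord N → Ambient N} {d : Fin N → Coord N → Ambient N},
      IsPotentialSubmanifold G η c Φ V s d →
      ContDiffOn ℝ ∞ (fun u => (fun i => pd i s u, fun i => d i u)) V ∧
      ∀ u ∈ V, ∀ k, pd k (fun u => (fun i => pd i s u, fun i => d i u)) u =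
        frameOperator c (fun l i => coeff η Φ l k i u) (fun i => pd i s u, fun i => d i u) := by
    intro s d hs
    have hsmooth := fun i => contDiffOn_pd hV hs.smooth_r i
    refine ⟨(contDiffOn_pi.2 hsmooth).prodMk (contDiffOn_pi.2 hs.smooth_b), fun u hu k => ?_⟩
    have hd1 := fun i => differentiableAt_of_contDiffOn hV (hsmooth i) hu
    have hd2 := fun i => differentiableAt_of_contDiffOn hV (hs.smooth_b i) hu
    rw [pd_prodMk (differentiableAt_pi.2 hd1) (differentiableAt_pi.2 hd2), pd_pi hd1, pd_pi hd2]
    simp only [hs.eq_r hη hc hG hU hΦ hV hVU hu, hs.eq_b hη hc hG hU hΦ hV hVU hu]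
    rfl
  have hA : IsPotentialSubmanifold G η c Φ V (fun u => L (r u)) fun α u => L (b α u) := by
    have hpd : ∀ u ∈ V, ∀ i, pd i (fun u => L (r u)) u = L (pd i r u) := fun u hu i =>
      pd_clm_comp L (differentiableAt_of_contDiffOn hV h.smooth_r hu) i
    have hpd2 : ∀ u ∈ V, ∀ i j, pd i (pd j fun u => L (r u)) u = L (pd i (pd j r) u) :=
      fun u hu i j => by
        rw [pd_congr hV (fun x hx => hpd x hx j) hu,
          pd_clm_comp L (differentiableAt_of_contDiffOn hV (contDiffOn_pd hV h.smooth_r j) hu)]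
    refine ⟨L.contDiff.comp_contDiffOn h.smooth_r, fun α => L.contDiff.comp_contDiffOn
      (h.smooth_b α), fun u hu => ?_, fun u hu => ?_, fun u hu α i => ?_, fun u hu α β => ?_,
      fun u hu α β i => ?_, fun u hu α i j => ?_⟩
    · simp only [hpd u hu]
      exact (h.immersion u hu).map' (A : Ambient N →ₗ[ℝ] Ambient N) A.ker
    · ext i j
      rw [firstForm, Matrix.of_apply, hpd u hu, hpd u hu, hL, hL, hAG]
      exact congrFun (congrFun (h.first_form u hu) i) j
    · rw [hpd u hu, hL, hL, hAG, h.normal u hu]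
    · simpa only [hL, hAG] using h.gram u hu α β
    · have := h.torsionless u hu α β i
      rw [torsion] at this ⊢
      rwa [pd_clm_comp L (differentiableAt_of_contDiffOn hV (h.smooth_b α) hu), hL, hL, hAG]
    · have := h.second_form u hu α i j
      rw [secondForm] at this ⊢
      rwa [hpd2 u hu, hL, hL, hAG]
  have hpdA : ∀ u ∈ V, ∀ i, pd i (fun u => L (r u)) u = L (pd i r u) := fun u hu i =>
    pd_clm_comp L (differentiableAt_of_contDiffOn hV h.smooth_r hu) i
  have key := eqOn_of_linear_system hV hVc
    (fun k y => (contDiffOn_frameOperator (η := η) (c := c) hU hΦ k y).mono hVU)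
    (hframe h').1 (hframe hA).1 (hframe h').2 (hframe hA).2 hu₀
    (by simp only [hpdA u₀ hu₀]; simp only [hL, hAr, hAb])
  simp only [Prod.mk.injEq] at key
  have hr := eqOn_add_const_of_pd_eq hV hVc h'.smooth_r hA.smooth_r
    (fun u hu i => congrFun (key u hu).1 i) hu₀
  exact ⟨A, r' u₀ - A (r u₀), hAG, fun u hu => ⟨hr u hu, fun α => congrFun (key u hu).2 α⟩⟩

end Uniqueness

/-! ### The signature criterion for existence. -/

section Realizability

/-- A frame at `u₀` already fixes the signature. Conversely the right signature gives an initial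
frame, (W) gives a solution of (L) with it, and its scalar products propagate over the ball. -/
theorem isRealizableNear_iff (hη : IsMetricMatrix η) (hc : c ≠ 0) (hG : IsPseudoEuclidean G)
    (hU : IsOpen U) (hΦ : ContDiffOn ℝ ∞ Φ U) (hW : WDVV η Φ U) {u₀ : Coord N} (hu₀ : u₀ ∈ U) :
    IsRealizableNear G η c Φ U u₀ ↔
      signature G = if 0 < c then 2 * signature (Matrix.toBilin' η) else 0 := by
  constructor
  · rintro ⟨V, -, huV, -, r, n, -, h⟩
    exact (h.isGramFrame huV).signature_eq hη hc hG.1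
  · intro hsig
    obtain ⟨p, q, hpq⟩ := IsGramFrame.exists_of_signature_eq hη hc hG hsig
    obtain ⟨ρ, hρ, hball, r, n, h, -, -, hr, hn⟩ :=
      exists_solvesSystem_ball (c := c) hη hU hΦ hW hu₀ 0 0 p q
    refine ⟨_, Metric.isOpen_ball, Metric.mem_ball_self hρ, hball, r, n, h,
      h.isPotentialSubmanifold hη hc hG.1 hU hΦ Metric.isOpen_ball
        (convex_ball u₀ ρ).isPreconnected hball (Metric.mem_ball_self hρ) ?_⟩
    simpa only [hr, hn] using hpq

end Realizability

end PotentialSubmanifold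

/-! ### Frobenius manifolds in flat charts: the potential and associativity. -/

namespace PotentialSubmanifold

variable {N : ℕ}

open Metric in
/-- A symmetric tensor with symmetric derivative is the third derivative of a function. -/
theorem exists_potential {U : Set (Coord N)} (hU : IsOpen U)
    {A : Fin N → Fin N → Fin N → Coord N → ℝ} (hA : ∀ i j k, ContDiffOn ℝ ∞ (A i j k) U)
    (h₁₂ : ∀ u ∈ U, ∀ i j k, A i j k u = A j i k u)
    (h₂₃ : ∀ u ∈ U, ∀ i j k, A i j k u = A i k j u)
    (hd : ∀ u ∈ U, ∀ i j k l, pd l (A i j k) u = pd k (A i j l) u) {u₀ : Coord N} (hu₀ : u₀ ∈ U) :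
    ∃ ρ > 0, ball u₀ ρ ⊆ U ∧ ∃ Φ : Coord N → ℝ, ContDiffOn ℝ ∞ Φ (ball u₀ ρ) ∧
      ∀ u ∈ ball u₀ ρ, ∀ i j k, third Φ i j k u = A i j k u := by
  have hAd := fun u hu i j k => differentiableAt_of_contDiffOn hU (hA i j k) (u := u) hu
  obtain ⟨ρ₁, hρ₁, hb₁, q, hqs, hq⟩ := exists_primitive_of_closed hU
    (a := fun k u i j => A i j k u)
    (fun k => contDiffOn_pi.2 fun i => contDiffOn_pi.2 fun j => hA i j k) (fun u hu l k => by
      have e : ∀ k, ∀ i, DifferentiableAt ℝ (fun u j => A i j k u) u :=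
        fun k i => differentiableAt_pi.2 fun j => hAd u hu i j k
      rw [pd_pi (e k), pd_pi (e l)]
      ext i j
      rw [pd_pi fun j => hAd u hu i j k, pd_pi fun j => hAd u hu i j l]
      exact hd u hu i j k l) hu₀
  have hqs' : ∀ i j, ContDiffOn ℝ ∞ (fun u => q u i j) (ball u₀ ρ₁) := fun i j =>
    contDiffOn_pi.1 (contDiffOn_pi.1 hqs i) j
  have hq' : ∀ u ∈ ball u₀ ρ₁, ∀ i j k, pd k (fun u => q u i j) u = A i j k u := by
    intro u hu i j k
    rw [← pd_apply (differentiableAt_of_contDiffOn isOpen_ball (contDiffOn_pi.1 hqs i) hu),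
      ← pd_apply (differentiableAt_of_contDiffOn isOpen_ball hqs hu), hq u hu]
  -- The primitives of A_ijk carry free constants and need not be symmetric in i, j. Averaging
  -- restores the symmetry needed for the last integration and keeps the derivative, since A itself
  -- is symmetric.
  have hss : ∀ i j, ContDiffOn ℝ ∞ (fun u => (2⁻¹ : ℝ) • (q u i j + q u j i)) (ball u₀ ρ₁) :=
    fun i j => ((hqs' i j).add (hqs' j i)).const_smul (2⁻¹ : ℝ)
  have hs : ∀ u ∈ ball u₀ ρ₁, ∀ i j k,
      pd k (fun u => (2⁻¹ : ℝ) • (q u i j + q u j i)) u = A i j k u := by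
    intro u hu i j k
    have e := fun i j => differentiableAt_of_contDiffOn isOpen_ball (hqs' i j) hu
    rw [pd_const_smul ((e i j).fun_add (e j i)), pd_add (e i j) (e j i), hq' u hu, hq' u hu,
      h₁₂ u (hb₁ hu) j i, ← two_smul ℝ, smul_smul]
    simp
  obtain ⟨ρ₂, hρ₂, hb₂, p, hps, hp⟩ := exists_primitive_of_closed isOpen_ball
    (a := fun k u i => (2⁻¹ : ℝ) • (q u i k + q u k i))
    (fun k => contDiffOn_pi.2 fun i => hss i k) (fun u hu l k => by
      have e := fun i j => differentiableAt_of_contDiffOn isOpen_ball (hss i j) hu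
      rw [pd_pi fun i => e i k, pd_pi fun i => e i l]
      ext i
      rw [hs u hu, hs u hu, h₂₃ u (hb₁ hu)]) (mem_ball_self hρ₁)
  have hp' : ∀ u ∈ ball u₀ ρ₂, ∀ i k,
      pd k (fun u => p u i) u = (2⁻¹ : ℝ) • (q u i k + q u k i) := by
    intro u hu i k
    rw [← pd_apply (differentiableAt_of_contDiffOn isOpen_ball hps hu), hp u hu]
  obtain ⟨ρ₃, hρ₃, hb₃, Φ, hΦs, hΦ⟩ := exists_primitive_of_closed isOpen_ball
    (a := fun k u => p u k) (fun k => contDiffOn_pi.1 hps k) (fun u hu l k => by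
      rw [hp' u hu, hp' u hu, add_comm]) (mem_ball_self hρ₂)
  refine ⟨ρ₃, hρ₃, (hb₃.trans hb₂).trans hb₁, Φ, hΦs, fun u hu i j k => ?_⟩
  have h2 : ∀ x ∈ ball u₀ ρ₃, pd j (pd k Φ) x = (2⁻¹ : ℝ) • (q x k j + q x j k) := fun x hx => by
    rw [pd_congr isOpen_ball (fun y hy => hΦ y hy k) hx, hp' x (hb₃ hx)]
  have hu₁ := hb₂ (hb₃ hu)
  rw [third, pd_congr isOpen_ball h2 hu, hs u hu₁, h₂₃ u (hb₁ hu₁), h₁₂ u (hb₁ hu₁),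
    h₂₃ u (hb₁ hu₁)]

section Chart

variable {M : Type*} [TopologicalSpace M] [ChartedSpace (Coord N) M]
  {φ : OpenPartialHomeomorph M (Coord N)}

theorem mdifferentiable_of_mem_maximalAtlas
    (hφ : φ ∈ IsManifold.maximalAtlas 𝓘(ℝ, Coord N) ∞ M) :
    φ.MDifferentiable 𝓘(ℝ, Coord N) 𝓘(ℝ, Coord N) :=
  ⟨fun _ hx => ((contMDiffAt_of_mem_maximalAtlas hφ hx).mdifferentiableAt
      (by simp)).mdifferentiableWithinAt,
    fun _ hx => ((contMDiffAt_symm_of_mem_maximalAtlas hφ hx).mdifferentiableAt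
      (by simp)).mdifferentiableWithinAt⟩

/-- The tangent vector with the components `x` in the chart `φ`. -/
noncomputable def vecOfComp (φ : OpenPartialHomeomorph M (Coord N)) (y : Coord N) :
    Coord N →ₗ[ℝ] TangentSpace 𝓘(ℝ, Coord N) (φ.symm y) :=
  (mfderiv 𝓘(ℝ, Coord N) 𝓘(ℝ, Coord N) φ.symm y : Coord N →L[ℝ] _).toLinearMap

theorem vecOfComp_eq_sum (y x : Coord N) :
    vecOfComp φ y x = ∑ i, x i • coordVec φ y i := by
  conv_lhs => rw [pi_eq_sum_univ' x]
  rw [map_sum]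
  refine Finset.sum_congr rfl fun i _ => ?_
  rw [map_smul]
  rfl

theorem vecComp_vecOfComp (hφ : φ ∈ IsManifold.maximalAtlas 𝓘(ℝ, Coord N) ∞ M) {y : Coord N}
    (hy : y ∈ φ.target) (x : Coord N) : vecComp φ y (vecOfComp φ y x) = x :=
  DFunLike.congr_fun ((mdifferentiable_of_mem_maximalAtlas hφ).comp_symm_deriv hy) x

theorem vecOfComp_vecComp (hφ : φ ∈ IsManifold.maximalAtlas 𝓘(ℝ, Coord N) ∞ M) {y : Coord N}
    (hy : y ∈ φ.target) (v : TangentSpace 𝓘(ℝ, Coord N) (φ.symm y)) :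
    vecOfComp φ y (vecComp φ y v) = v := by
  obtain ⟨x, rfl⟩ : ∃ x, vecOfComp φ y x = v :=
    (mdifferentiable_of_mem_maximalAtlas hφ).symm.mfderiv_surjective hy v
  rw [vecComp_vecOfComp hφ hy]

variable (F : FrobeniusManifold N M) {η : Matrix (Fin N) (Fin N) ℝ}

theorem metric_vecOfComp {g : ∀ p : M, LinearMap.BilinForm ℝ (TangentSpace 𝓘(ℝ, Coord N) p)}
    (y x z : Coord N) : g (φ.symm y) (vecOfComp φ y x) (vecOfComp φ y z) =
      Matrix.toBilin' (metricComp g φ y) x z := by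
  rw [Matrix.toBilin'_apply, vecOfComp_eq_sum, vecOfComp_eq_sum]
  simp only [map_sum, map_smul, LinearMap.sum_apply, LinearMap.smul_apply, smul_eq_mul, metricComp,
    Matrix.of_apply, Finset.mul_sum]
  rw [Finset.sum_comm]
  exact Finset.sum_congr rfl fun i _ => Finset.sum_congr rfl fun j _ => by ring

/-- The derivative of a chart is invertible, so symmetry and nondegeneracy of the metric pass to the
matrix of its components. A point of the target is needed to compare them. -/
theorem isMetricMatrix_of_isFlatChart (hφ : IsFlatChart F.g φ η) {y : Coord N}
    (hy : y ∈ φ.target) : IsMetricMatrix η := by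
  have hη := hφ.2 y hy
  refine ⟨?_, ?_⟩
  · rw [← hη]
    exact Matrix.ext fun i j => (F.g_symm _).eq _ _
  · rw [← LinearMap.BilinForm.nondegenerate_toBilin'_iff_det_ne_zero]
    have hsymm : ∀ x z, Matrix.toBilin' η x z = Matrix.toBilin' η z x := fun x z => by
      rw [← hη, ← metric_vecOfComp, ← metric_vecOfComp, (F.g_symm _).eq]
    have hleft : (Matrix.toBilin' η).SeparatingLeft := by
      intro x hx
      have : vecOfComp φ y x = 0 := (F.g_nondegenerate _).1 _ fun v => by
        rw [← vecOfComp_vecComp hφ.1 hy v, metric_vecOfComp, hη, hx]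
      rw [← vecComp_vecOfComp hφ.1 hy x, this]
      exact map_zero (mfderiv 𝓘(ℝ, Coord N) 𝓘(ℝ, Coord N) φ (φ.symm y))
    exact ⟨hleft, fun x hx => hleft x fun z => by rw [hsymm, hx]⟩

theorem mul_coordVec (hφ : φ ∈ IsManifold.maximalAtlas 𝓘(ℝ, Coord N) ∞ M) {y : Coord N}
    (hy : y ∈ φ.target) (i j : Fin N) :
    F.mul (φ.symm y) (coordVec φ y i) (coordVec φ y j) =
      ∑ k, mulComp F.mul φ k i j y • coordVec φ y k := by
  rw [← vecOfComp_vecComp hφ hy (F.mul _ _ _), vecOfComp_eq_sum]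
  rfl

theorem cubicComp_eq_sum (hφ : IsFlatChart F.g φ η) {y : Coord N} (hy : y ∈ φ.target)
    (i j k : Fin N) :
    cubicComp F.g F.mul φ i j k y = ∑ l, mulComp F.mul φ l i j y * η l k := by
  rw [cubicComp, mul_coordVec F hφ.1 hy, ← hφ.2 y hy]
  simp [metricComp]

theorem cubicComp_comm₁₂ (i j k : Fin N) (y : Coord N) :
    cubicComp F.g F.mul φ i j k y = cubicComp F.g F.mul φ j i k y := by
  rw [cubicComp, F.mul_comm]
  rfl

/-- Commutativity and invariance combine: g(X∘Y, Z) = g(Y, X∘Z). With `cubicComp_comm₁₂` this makes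
A totally symmetric. -/
theorem cubicComp_comm₂₃ (i j k : Fin N) (y : Coord N) :
    cubicComp F.g F.mul φ i j k y = cubicComp F.g F.mul φ i k j y := by
  rw [cubicComp_comm₁₂, cubicComp, cubicComp, F.invariant, (F.g_symm _).eq]

theorem mulComp_comm (k i j : Fin N) (y : Coord N) :
    mulComp F.mul φ k i j y = mulComp F.mul φ k j i y := by
  rw [mulComp, F.mul_comm]
  rfl

theorem coordVec_injective_sum (hφ : φ ∈ IsManifold.maximalAtlas 𝓘(ℝ, Coord N) ∞ M)
    {y : Coord N} (hy : y ∈ φ.target) {x z : Coord N}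
    (h : ∑ i, x i • coordVec φ y i = ∑ i, z i • coordVec φ y i) : x = z := by
  rw [← vecOfComp_eq_sum, ← vecOfComp_eq_sum] at h
  rw [← vecComp_vecOfComp hφ hy x, h, vecComp_vecOfComp hφ hy]

theorem mulComp_assoc (hφ : φ ∈ IsManifold.maximalAtlas 𝓘(ℝ, Coord N) ∞ M) {y : Coord N}
    (hy : y ∈ φ.target) (i j m n : Fin N) :
    ∑ l, mulComp F.mul φ l i j y * mulComp F.mul φ n l m y =
      ∑ l, mulComp F.mul φ l j m y * mulComp F.mul φ n i l y := by
  have h := F.mul_assoc (φ.symm y) (coordVec φ y i) (coordVec φ y j) (coordVec φ y m)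
  rw [mul_coordVec F hφ hy i j, mul_coordVec F hφ hy j m] at h
  simp only [map_sum, map_smul, LinearMap.sum_apply, LinearMap.smul_apply, mul_coordVec F hφ hy,
    Finset.smul_sum, smul_smul] at h
  rw [Finset.sum_comm, Finset.sum_comm (f := fun l k => (mulComp F.mul φ l j m y * _) • _)] at h
  simp only [← Finset.sum_smul] at h
  exact congrFun (coordVec_injective_sum hφ hy
    (x := fun n => ∑ l, mulComp F.mul φ l i j y * mulComp F.mul φ n l m y)
    (z := fun n => ∑ l, mulComp F.mul φ l j m y * mulComp F.mul φ n i l y) h) n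

variable {F} {Φ : Coord N → ℝ}

theorem IsGivenBy.mulComp_eq_coeff (h : IsGivenBy F φ η Φ) {y : Coord N} (hy : y ∈ φ.target)
    (k i j : Fin N) : mulComp F.mul φ k i j y = coeff η Φ k i j y := by
  rw [h.structural y hy, coeff]
  have hs : (η⁻¹).IsSymm := by rw [Matrix.IsSymm, Matrix.transpose_nonsing_inv, h.metric.1.eq]
  refine Finset.sum_congr rfl fun s _ => ?_
  rw [hs.apply s k, third_comm₁₂ φ.open_target h.smooth hy s i,
    third_comm₂₃ φ.open_target h.smooth hy i s]

/-- Associativity of a commutative product means that multiplications by ∂_j and ∂_m commute, which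
is (W) in the form of `wdvv_iff_coeff`. -/
theorem IsGivenBy.wdvv (h : IsGivenBy F φ η Φ) : WDVV η Φ φ.target := by
  rw [wdvv_iff_coeff h.metric]
  intro y hy i j m n
  simp only [← h.mulComp_eq_coeff hy]
  have h1 := mulComp_assoc F h.flat_chart.1 hy j i m n
  simp only [mulComp_comm F n j] at h1
  simpa only [mulComp_comm F _ j i] using h1

theorem IsGivenBy.realizes (h : IsGivenBy F φ η Φ) {c : ℝ}
    {G : LinearMap.BilinForm ℝ (Ambient N)} {V : Set (Coord N)} (hV : V ⊆ φ.target)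
    {r : Coord N → Ambient N} {b : Fin N → Coord N → Ambient N}
    (hr : IsPotentialSubmanifold G η c Φ V r b) : Realizes F φ G V r b := by
  refine fun y hy => ⟨?_, fun k i j => ?_⟩
  · rw [h.flat_chart.2 y (hV hy), hr.first_form y hy]
  · rw [h.structural y (hV hy), hr.first_form y hy]
    refine Finset.sum_congr rfl fun s _ => ?_
    rw [hr.second_form y hy, third_comm₁₂ φ.open_target h.smooth (hV hy)]

theorem isFlatChart_restr
    {g : ∀ p : M, LinearMap.BilinForm ℝ (TangentSpace 𝓘(ℝ, Coord N) p)}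
    (hφ : IsFlatChart g φ η) {s : Set M} (hs : IsOpen s) : IsFlatChart g (φ.restr s) η :=
  ⟨restr_mem_maximalAtlas (contDiffGroupoid ∞ 𝓘(ℝ, Coord N)) hφ.1 hs, fun y hy => hφ.2 y hy.1⟩

open Metric in
-- In a flat chart A has symmetric components with symmetric derivatives, so it consists of the
-- third derivatives of some Φ; raising an index returns the product.
theorem exists_isGivenBy (F : FrobeniusManifold N M) (p : M) :
    ∃ (φ : OpenPartialHomeomorph M (Coord N)) (η : Matrix (Fin N) (Fin N) ℝ) (Φ : Coord N → ℝ),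
      p ∈ φ.source ∧ IsGivenBy F φ η Φ := by
  obtain ⟨φ, η, hp, hφ⟩ := F.flat p
  have hy₀ := φ.map_source hp
  have hη := isMetricMatrix_of_isFlatChart F hφ hy₀
  have hsmooth : ∀ i j k, ContDiffOn ℝ ∞ (cubicComp F.g F.mul φ i j k) φ.target := fun i j k =>
    (ContDiffOn.sum fun l _ => (F.smooth_mul φ η hφ l i j).mul contDiffOn_const).congr
      fun y hy => cubicComp_eq_sum F hφ hy i j k
  obtain ⟨ρ, hρ, hball, Φ, hΦs, hΦ⟩ := exists_potential φ.open_target hsmooth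
    (fun u _ i j k => cubicComp_comm₁₂ F i j k u) (fun u _ i j k => cubicComp_comm₂₃ F i j k u)
    (fun u hu i j k l => F.nabla_cubic φ η hφ u hu i j k l) hy₀
  -- The potential exists only on a ball, so the chart is cut down to the preimage of that ball.
  have hs : IsOpen (φ.source ∩ φ ⁻¹' ball (φ p) ρ) := φ.isOpen_inter_preimage isOpen_ball
  have htarget : ∀ y ∈ (φ.restr (φ.source ∩ φ ⁻¹' ball (φ p) ρ)).target,
      y ∈ φ.target ∧ y ∈ ball (φ p) ρ := by
    intro y hy
    have h1 : y ∈ φ.target := hy.1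
    have h2 : φ.symm y ∈ interior (φ.source ∩ φ ⁻¹' ball (φ p) ρ) := hy.2
    rw [hs.interior_eq] at h2
    exact ⟨h1, by simpa [φ.right_inv h1] using h2.2⟩
  refine ⟨φ.restr (φ.source ∩ φ ⁻¹' ball (φ p) ρ), η, Φ, ?_, hη, isFlatChart_restr hφ hs,
    hΦs.mono fun y hy => (htarget y hy).2, fun y hy k i j => ?_⟩
  · rw [OpenPartialHomeomorph.restr_source, hs.interior_eq]
    exact ⟨hp, hp, mem_ball_self hρ⟩
  · obtain ⟨h1, h2⟩ := htarget y hy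
    change mulComp F.mul φ k i j y = _
    have e : ∀ s, third Φ s i j y = ∑ l, mulComp F.mul φ l i j y * η l s := fun s => by
      rw [hΦ y h2, cubicComp_comm₁₂, cubicComp_comm₂₃, cubicComp_eq_sum F hφ h1]
    simp only [e, Finset.mul_sum]
    rw [Finset.sum_comm]
    have h3 : ∀ l, ∑ s, η⁻¹ k s * (mulComp F.mul φ l i j y * η l s) =
        if k = l then mulComp F.mul φ l i j y else 0 := by
      intro l
      calc _ = (∑ s, η⁻¹ k s * η s l) * mulComp F.mul φ l i j y := by
            rw [Finset.sum_mul]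
            exact Finset.sum_congr rfl fun s _ => by rw [hη.1.apply l s]; ring
        _ = _ := by rw [inv_mul_cancel_sum hη]; simp
    simp [h3]

end Chart

end PotentialSubmanifold

/-! ### Assembly of the theorem. -/

theorem mainTheorem5 {N : ℕ} {M : Type*} [TopologicalSpace M] [ChartedSpace (Coord N) M]
    [IsManifold 𝓘(ℝ, Coord N) ∞ M] (F : FrobeniusManifold N M) :
    -- the Frobenius manifold is locally given by a solution of the associativity equations
    (∀ p : M, ∃ (φ : OpenPartialHomeomorph M (Coord N)) (η : Matrix (Fin N) (Fin N) ℝ)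
        (Φ : Coord N → ℝ), p ∈ φ.source ∧ IsGivenBy F φ η Φ) ∧
    -- whenever it is given by `Φ`, the submanifolds that belong to `Φ` realize it, for every `c`
    (∀ (φ : OpenPartialHomeomorph M (Coord N)) (η : Matrix (Fin N) (Fin N) ℝ) (Φ : Coord N → ℝ),
      IsGivenBy F φ η Φ →
        WDVV η Φ φ.target ∧
        ∀ (c : ℝ), c ≠ 0 → ∀ (G : LinearMap.BilinForm ℝ (Ambient N)), IsPseudoEuclidean G →
          ∀ (V : Set (Coord N)), IsOpen V → V ⊆ φ.target →
          ∀ (r : Coord N → Ambient N) (b : Fin N → Coord N → Ambient N),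
            IsPotentialSubmanifold G η c Φ V r b → Realizes F φ G V r b) ∧
    (∀ (η : Matrix (Fin N) (Fin N) ℝ) (U : Set (Coord N)) (Φ : Coord N → ℝ),
      IsMetricMatrix η → IsOpen U → ContDiffOn ℝ ∞ Φ U →
        -- the consistency of the linear system is equivalent to the associativity equations
        (∀ c : ℝ, c ≠ 0 → (IsConsistent η c Φ U ↔ WDVV η Φ U)) ∧
        (WDVV η Φ U →
          (∀ c : ℝ, c ≠ 0 →
            (∀ G : LinearMap.BilinForm ℝ (Ambient N), IsPseudoEuclidean G →
              -- the submanifolds that belong to `Φ` satisfy the linear system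
              (∀ (V : Set (Coord N)), IsOpen V → V ⊆ U →
                ∀ (r : Coord N → Ambient N) (b : Fin N → Coord N → Ambient N),
                  IsPotentialSubmanifold G η c Φ V r b →
                  ∀ u₀ ∈ V, ∃ W : Set (Coord N), IsOpen W ∧ u₀ ∈ W ∧ W ⊆ V ∧
                    ∃ n : Coord N → Ambient N,
                      (∀ u ∈ W, ∀ α, pd α n u = b α u) ∧ SolvesSystem η c Φ W r n) ∧
              -- a solution whose derivatives have the right scalar products at one point is one
              (∀ (V : Set (Coord N)), IsOpen V → IsPreconnected V → V ⊆ U →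
                ∀ (r n : Coord N → Ambient N), SolvesSystem η c Φ V r n →
                  (∃ u₀ ∈ V, ∀ i j, G (pd i r u₀) (pd j r u₀) = η i j ∧
                    G (pd i n u₀) (pd j r u₀) = 0 ∧
                    G (pd i n u₀) (pd j n u₀) = c⁻¹ * η i j) →
                  IsPotentialSubmanifold G η c Φ V r fun α => pd α n) ∧
              -- the submanifold is unique up to motions
              (∀ (V : Set (Coord N)), IsOpen V → IsPreconnected V → V ⊆ U →
                ∀ (r r' : Coord N → Ambient N) (b b' : Fin N → Coord N → Ambient N),
                  IsPotentialSubmanifold G η c Φ V r b →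
                  IsPotentialSubmanifold G η c Φ V r' b' →
                  ∃ (A : Ambient N ≃ₗ[ℝ] Ambient N) (v : Ambient N),
                    (∀ x y, G (A x) (A y) = G x y) ∧
                    ∀ u ∈ V, r' u = A (r u) + v ∧ ∀ α, b' α u = A (b α u)) ∧
              -- it exists exactly for one signature of the ambient space
              (∀ u₀ ∈ U, (IsRealizableNear G η c Φ U u₀ ↔
                signature G = if 0 < c then 2 * signature (Matrix.toBilin' η) else 0))) ∧
            -- and an ambient space of this signature exists
            (∃ G : LinearMap.BilinForm ℝ (Ambient N), IsPseudoEuclidean G ∧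
              ∀ u₀ ∈ U, IsRealizableNear G η c Φ U u₀)) ∧
          -- the signatures for `c = 1` and `c = -1` are different
          (signature (Matrix.toBilin' η) ≠ 0 → ∀ u₀ ∈ U,
            ∀ G₁ G₂ : LinearMap.BilinForm ℝ (Ambient N),
              IsPseudoEuclidean G₁ → IsPseudoEuclidean G₂ →
              IsRealizableNear G₁ η 1 Φ U u₀ → IsRealizableNear G₂ η (-1) Φ U u₀ →
              signature G₁ ≠ signature G₂))) := by
  refine ⟨exists_isGivenBy F, fun φ η Φ h => ⟨h.wdvv, fun c _ G _ V _ hV r b hr =>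
    h.realizes hV hr⟩, fun η U Φ hη hU hΦ => ⟨fun c hc => isConsistent_iff_wdvv hη hU hΦ hc,
    fun hW => ⟨fun c hc => ⟨fun G hG => ⟨fun V hV hVU r b h u₀ hu₀ =>
      h.exists_solvesSystem hη hc hG hU hΦ hV hVU hu₀, ?_, fun V hV hVc hVU r r' b b' h h' =>
      h.exists_motion hη hc hG hU hΦ hV hVc hVU h', fun u₀ hu₀ =>
      isRealizableNear_iff hη hc hG hU hΦ hW hu₀⟩, ?_⟩, ?_⟩⟩⟩
  · rintro V hV hVc hVU r n h ⟨u₀, hu₀, h0⟩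
    exact h.isPotentialSubmanifold hη hc hG.1 hU hΦ hV hVc hVU hu₀
      ⟨fun i j => (h0 i j).1, fun i j => (h0 i j).2.1, fun i j => (h0 i j).2.2⟩
  · obtain ⟨G, hG, hsig⟩ := exists_isPseudoEuclidean_signature hη hc
    exact ⟨G, hG, fun u₀ hu₀ => (isRealizableNear_iff hη hc hG hU hΦ hW hu₀).2 hsig⟩
  · intro hsig u₀ hu₀ G₁ G₂ hG₁ hG₂ h₁ h₂
    rw [isRealizableNear_iff hη one_ne_zero hG₁ hU hΦ hW hu₀] at h₁
    rw [isRealizableNear_iff hη (by norm_num) hG₂ hU hΦ hW hu₀] at h₂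
    -- The two ambient signatures are 2 sign(η) and 0.
    rw [h₁, h₂, if_pos one_pos, if_neg (by norm_num)]
    simpa using hsig
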